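/- **Setting.** Let $\mathcal A$ be a finite nonempty set of predictions, $r:\mathcal A\times\mathcal B\to\mathbb R$ a reward function and $h:\mathcal A\times\mathcal B\to\mathcal H$ a feedback function. The outcomes $b_1,b_2,\dots$ are i.i.d. with values in $\mathcal B$, and $\mu_i=\mathbb E[r(i,b_1)]$ is finite for every $i\in\mathcal A$. Put $\mu^*=\max_i\mu_i$ and $\Delta_i=\mu^*-\mu_i$. For $i\in\mathcal A$ and $t\ge1$ let $\tau_{i,t}$ be a random delay with values in $\{0,1,2,\dots\}$. At each instant $t=1,2,\dots$ the forecaster makes a prediction $a_t\in\mathcal A$ and gains the (hidden) reward $r(a_t,b_t)$; the feedback $h_t=h(a_t,b_t)$, with its time stamp $t$, is revealed at the end of instant $t+\tau_t$, where $\tau_t=\tau_{a_t,t}$. **Algorithms.** $\textsc{Base}$ is any (possibly randomized) algorithm for the non-delayed problem: in its current state it makes a prediction, and after it has received one feedback for this prediction it moves to its next state. The sequence $(b_t)_t$ is independent of the pair formed by all the delays and the internal randomization of $\textsc{Base}$. The algorithm QPM-D keeps a FIFO buffer $Q[i]$ for each $i\in\mathcal A$, initially empty. At each instant $t$, as long as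 $Q[I]$ is not empty for the current prediction $I$ of $\textsc{Base}$, it removes the oldest feedback from $Q[I]$ and gives it to $\textsc{Base}$; then it predicts $a_t=I$. At the end of instant $t$, each feedback $h_s$ revealed then is appended to $Q[a_s]$; feedbacks revealed at the same time are processed in an order that depends only on the instant and on their time stamps. **Notation.** Let $T_i(t)$ be the number of times that QPM-D predicts $i$ in instants $1,\dots,t$, $S_i(t)$ the number of feedbacks for prediction $i$ that it has received by the end of instant $t$, $G_{i,t}=T_i(t-1)-S_i(t-1)$ and $G^*_{i,n}=\max_{1\le t\le n}G_{i,t}$. Let $R_n=\sum_{t=1}^n(\mu^*-r(a_t,b_t))$ be the regret of QPM-D. Let $T^{\textsc{Base}}_i(n)$ and $R^{\textsc{Base}}_n$ be the corresponding count and regret when $\textsc{Base}$ is run in the same environment without delays. **Theorem.** For every $n\ge1$ the variables $R_n$, $R^{\textsc{Base}}_n$, $T_i(n)$, $T_i^{\textsc{Base}}(n)$ and $G^*_{i,n}$ are integrable, $$\mathbb E[R_n]=\sum_{i\in\mathcal A}\Delta_i\,\mathbb E[T_i(n)],\qquad \mathbb E[R^{\textsc{Base}}_n]=\sum_{i\in\mathcal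 A}\Delta_i\,\mathbb E[T^{\textsc{Base}}_i(n)],$$ and $$\mathbb E[R_n]\le\mathbb E[R^{\textsc{Base}}_n]+\sum_{i\in\mathcal A}\Delta_i\,\mathbb E[G^*_{i,n}].$$ The regrets in hindsight, $\max_{i\in\mathcal A}\sum_{t=1}^n r(i,b_t)-\sum_{t=1}^n r(a_t,b_t)$ for QPM-D and the same expression for $\textsc{Base}$ without delays, are integrable as well, and the last inequality also holds with them in place of $R_n$ and $R_n^{\textsc{Base}}$. -/

import Mathlib

open MeasureTheory ProbabilityTheory

/-- A non-delayed online algorithm with predictions in `A` and feedbacks in `H`: in its current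
state it makes a prediction, and after receiving one feedback for that prediction it moves to the
next state.  The state may record the whole past, and it may carry a tape of random numbers that
were drawn before the first step, so that (with a random initial state) every randomized algorithm
is of this form. -/
structure BaseAlg (A H S : Type*) [MeasurableSpace H] [MeasurableSpace S] where
  /-- the prediction made in a given state -/
  predict : S → A
  /-- the state after the current prediction has received the given feedback -/
  update : S → H → S
  measurableSet_predict : ∀ i : A, MeasurableSet (predict ⁻¹' {i})
  measurable_update : Measurable (Function.uncurry update)

namespace BaseAlg

variable {A H S B : Type*} [MeasurableSpace H] [MeasurableSpace S]

/-- State of the algorithm after `t` steps in the environment without delays, with feedback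
function `h`, outcomes `b 0, b 1, …` and initial state `s₀`. -/
def run (alg : BaseAlg A H S) (h : A → B → H) (b : ℕ → B) (s₀ : S) : ℕ → S
  | 0 => s₀
  | t + 1 =>
    alg.update (run alg h b s₀ t) (h (alg.predict (run alg h b s₀ t)) (b t))

/-- The prediction of the algorithm at instant `t` (`t = 0, 1, …`) without delays. -/
def action (alg : BaseAlg A H S) (h : A → B → H) (b : ℕ → B) (s₀ : S) (t : ℕ) : A :=
  alg.predict (alg.run h b s₀ t)

end BaseAlg

/-- Configuration of the queued algorithm together with the record of the interaction. -/
structure QPMD (A S : Type*) where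
  /-- current state of the base algorithm -/
  base : S
  /-- the FIFO buffers `Q[i]`; a buffered feedback `h_s` is stored through its time stamp `s` -/
  queue : A → List ℕ
  /-- `past s` is the prediction made at instant `s`; only instants that have already been played
  are ever looked up -/
  past : ℕ → A

namespace QPMD

variable {A H S B : Type*} [DecidableEq A] [MeasurableSpace H] [MeasurableSpace S]

/-- One test of the while loop, where `I` is the current prediction of the base algorithm: if
`Q[I]` is empty nothing happens; otherwise the oldest feedback in `Q[I]` is removed and given to
the base algorithm. -/
def feedOnce (alg : BaseAlg A H S) (h : A → B → H) (b : ℕ → B) (c : QPMD A S) : QPMD A S :=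
  match c.queue (alg.predict c.base) with
  | [] => c
  | s :: q =>
    { c with
      base := alg.update c.base (h (c.past s) (b s))
      queue := Function.update c.queue (alg.predict c.base) q }

/-- Number of buffered feedbacks. -/
def buffered [Fintype A] (c : QPMD A S) : ℕ := ∑ i, (c.queue i).length

/-- The complete while loop.  Every effective pass removes one buffered feedback, so the loop is
over after at most `buffered` passes (see `queue_drain`). -/
def drain [Fintype A] (alg : BaseAlg A H S) (h : A → B → H) (b : ℕ → B) (c : QPMD A S) :
    QPMD A S :=
  (feedOnce alg h b)^[c.buffered] c

lemma buffered_feedOnce [Fintype A] (alg : BaseAlg A H S) (h : A → B → H) (b : ℕ → B)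
    (c : QPMD A S) (hc : c.queue (alg.predict c.base) ≠ []) :
    (feedOnce alg h b c).buffered + 1 = c.buffered := by
  rcases hq : c.queue (alg.predict c.base) with _ | ⟨s, q⟩
  · exact absurd hq hc
  · have h0 : (feedOnce alg h b c).queue = Function.update c.queue (alg.predict c.base) q := by
      simp [feedOnce, hq]
    unfold buffered
    rw [h0, ← Finset.add_sum_erase _ _ (Finset.mem_univ (alg.predict c.base)),
      ← Finset.add_sum_erase Finset.univ (fun i => (c.queue i).length)
        (Finset.mem_univ (alg.predict c.base))]
    have h1 : ∑ x ∈ Finset.univ.erase (alg.predict c.base),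
        (Function.update c.queue (alg.predict c.base) q x).length =
        ∑ x ∈ Finset.univ.erase (alg.predict c.base), (c.queue x).length := by
      refine Finset.sum_congr rfl fun x hx => ?_
      rw [Function.update_of_ne (Finset.ne_of_mem_erase hx)]
    rw [h1, Function.update_self, hq, List.length_cons]
    omega

lemma queue_iterate_feedOnce [Fintype A] (alg : BaseAlg A H S) (h : A → B → H) (b : ℕ → B)
    (m : ℕ) : ∀ c : QPMD A S, c.buffered ≤ m →
      ((feedOnce alg h b)^[m] c).queue (alg.predict ((feedOnce alg h b)^[m] c).base) = [] := by
  induction m with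
  | zero =>
    intro c hc
    have h0 : ∑ i, (c.queue i).length = 0 := Nat.le_zero.mp hc
    have h1 := (Finset.sum_eq_zero_iff.mp h0) (alg.predict c.base) (Finset.mem_univ _)
    simpa using h1
  | succ m ih =>
    intro c hc
    by_cases hq : c.queue (alg.predict c.base) = []
    · have h0 : feedOnce alg h b c = c := by simp [feedOnce, hq]
      rw [Function.iterate_fixed h0]
      exact hq
    · rw [Function.iterate_succ_apply]
      have h1 := buffered_feedOnce alg h b c hq
      exact ih _ (by omega)

/-- The exit condition of the while loop: there is no buffered feedback for the current prediction
of the base algorithm. -/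
lemma queue_drain [Fintype A] (alg : BaseAlg A H S) (h : A → B → H) (b : ℕ → B)
    (c : QPMD A S) :
    (drain alg h b c).queue (alg.predict (drain alg h b c).base) = [] :=
  queue_iterate_feedOnce alg h b _ c le_rfl

/-- Time stamps of the feedbacks that are revealed at the end of instant `t`: those of the
instants `s ≤ t` with `s + τ_s = t`, where `τ_s = d (a_s) s`. -/
def arrivals (d : A → ℕ → ℕ) (past : ℕ → A) (t : ℕ) : Finset ℕ :=
  (Finset.range (t + 1)).filter fun s => s + d (past s) s = t

/-- Append the time stamps in the list `l`, one after the other, to the buffers of the predictions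
that they belong to. -/
def enqueue (past : ℕ → A) (Q : A → List ℕ) (l : List ℕ) : A → List ℕ :=
  l.foldl (fun Q s => Function.update Q (past s) (Q (past s) ++ [s])) Q

/-- One time instant `t`: run the while loop, predict what the base algorithm predicts, and add
the feedbacks revealed at the end of the instant to the buffers.  `order t F` is the order in which
the time stamps in `F` are processed at instant `t`. -/
def step [Fintype A] (alg : BaseAlg A H S) (h : A → B → H) (order : ℕ → Finset ℕ → List ℕ)
    (d : A → ℕ → ℕ) (b : ℕ → B) (t : ℕ) (c : QPMD A S) : QPMD A S :=
  let c' := drain alg h b c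
  let past' := Function.update c'.past t (alg.predict c'.base)
  { base := c'.base
    queue := enqueue past' c'.queue (order t (arrivals d past' t))
    past := past' }

/-- The configuration at the beginning of instant `t` (`t = 0, 1, …`), for delays `d i t`
(the delay of the feedback of instant `t` if `i` is predicted then), outcomes `b t` and initial
state `s₀` of the base algorithm. -/
def run [Fintype A] (alg : BaseAlg A H S) (h : A → B → H) (order : ℕ → Finset ℕ → List ℕ)
    (d : A → ℕ → ℕ) (b : ℕ → B) (s₀ : S) : ℕ → QPMD A S
  | 0 => { base := s₀, queue := fun _ => [], past := fun _ => alg.predict s₀ }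
  | t + 1 => step alg h order d b t (run alg h order d b s₀ t)

/-- The prediction of the queued algorithm at instant `t`. -/
def action [Fintype A] (alg : BaseAlg A H S) (h : A → B → H) (order : ℕ → Finset ℕ → List ℕ)
    (d : A → ℕ → ℕ) (b : ℕ → B) (s₀ : S) (t : ℕ) : A :=
  alg.predict (drain alg h b (run alg h order d b s₀ t)).base

end QPMD

section Counts

variable {A : Type*} [DecidableEq A]

/-- `T_i(t)`: how often `i` is predicted in the first `t` instants. -/
def numPred (a : ℕ → A) (i : A) (t : ℕ) : ℕ :=
  ((Finset.range t).filter fun s => a s = i).card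

/-- `S_i(t)`: the number of feedbacks for `i` received by the end of the first `t` instants,
that is, by the end of the instant with index `t - 1`. -/
def numReceived (d : A → ℕ → ℕ) (a : ℕ → A) (i : A) (t : ℕ) : ℕ :=
  ((Finset.range t).filter fun s => a s = i ∧ s + d (a s) s < t).card

lemma numReceived_le_numPred (d : A → ℕ → ℕ) (a : ℕ → A) (i : A) (t : ℕ) :
    numReceived d a i t ≤ numPred a i t :=
  Finset.card_le_card fun s hs => by
    simp only [Finset.mem_filter] at hs ⊢
    exact ⟨hs.1, hs.2.1⟩

/-- The number of missing feedbacks for `i` when the prediction of instant `t` is made, i.e. after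
`t` complete instants (the subtraction does not truncate, by `numReceived_le_numPred`). -/
def numMissing (d : A → ℕ → ℕ) (a : ℕ → A) (i : A) (t : ℕ) : ℕ :=
  numPred a i t - numReceived d a i t

/-- `G*_{i,n}`: the largest number of missing feedbacks for `i` at the first `n` predictions. -/
def maxMissing (d : A → ℕ → ℕ) (a : ℕ → A) (i : A) (n : ℕ) : ℕ :=
  (Finset.range n).sup fun t => numMissing d a i t

end Counts

section Regret

variable {A B Ω : Type*} [MeasurableSpace Ω]

/-- `μ_i`, the expected reward of predicting `i` when the outcome is distributed as `b`. -/
noncomputable def meanReward (P : Measure Ω) (r : A → B → ℝ) (b : Ω → B) (i : A) : ℝ :=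
  ∫ ω, r i (b ω) ∂P

/-- `μ* = max_i μ_i`. -/
noncomputable def bestMean (P : Measure Ω) (r : A → B → ℝ) (b : Ω → B) : ℝ :=
  ⨆ i, meanReward P r b i

/-- `Δ_i = μ* - μ_i`. -/
noncomputable def gap (P : Measure Ω) (r : A → B → ℝ) (b : Ω → B) (i : A) : ℝ :=
  bestMean P r b - meanReward P r b i

/-- The regret after `n` instants of the predictions `a` against the optimal expected reward `m`
per instant. -/
noncomputable def stochRegret (m : ℝ) (r : A → B → ℝ) (b : ℕ → B) (a : ℕ → A) (n : ℕ) : ℝ :=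
  ∑ t ∈ Finset.range n, (m - r (a t) (b t))

/-- The regret after `n` instants of the predictions `a` against the best fixed prediction in
hindsight. -/
noncomputable def hindsightRegret (r : A → B → ℝ) (b : ℕ → B) (a : ℕ → A) (n : ℕ) : ℝ :=
  (⨆ i, ∑ t ∈ Finset.range n, r i (b t)) - ∑ t ∈ Finset.range n, r (a t) (b t)

end Regret

open scoped ENNReal

/-! ### Resampling one coordinate of an i.i.d. sequence. -/

section Resampling

variable {B Z : Type*} [MeasurableSpace B] [MeasurableSpace Z]

/-- Replacing one coordinate of an i.i.d. sequence by a fresh sample does not change its law. -/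
lemma measurePreserving_update_infinitePi (ν : Measure B) [IsProbabilityMeasure ν] (s : ℕ) :
    MeasurePreserving (fun p : (ℕ → B) × B => Function.update p.1 s p.2)
      ((Measure.infinitePi fun _ : ℕ => ν).prod ν) (Measure.infinitePi fun _ : ℕ => ν) := by
  have hm : Measurable fun p : (ℕ → B) × B => Function.update p.1 s p.2 := measurable_update'
  refine ⟨hm, Measure.eq_infinitePi _ fun I t ht => ?_⟩
  rw [Measure.map_apply hm (.pi I.countable_toSet fun i _ => ht i)]
  -- For a cylinder constraining `s`, the fresh sample supplies the factor of `s` and the old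
  -- coordinate is free; otherwise the fresh sample is unconstrained.
  by_cases hs : s ∈ I
  · have h1 : (fun p : (ℕ → B) × B => Function.update p.1 s p.2) ⁻¹' (I : Set ℕ).pi t =
        ((I.erase s : Finset ℕ) : Set ℕ).pi t ×ˢ t s := by
      ext ⟨b, x⟩
      simp only [Set.mem_preimage, Set.mem_pi, Set.mem_prod, Finset.mem_coe, Finset.mem_erase]
      constructor
      · intro H
        refine ⟨fun i hi => ?_, ?_⟩
        · simpa [Function.update_of_ne hi.1] using H i hi.2
        · simpa using H s hs
      · rintro ⟨H1, H2⟩ i hi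
        rcases eq_or_ne i s with rfl | his
        · simpa using H2
        · simpa [Function.update_of_ne his] using H1 i ⟨his, hi⟩
    rw [h1, Measure.prod_prod, Measure.infinitePi_pi _ fun i _ => ht i,
      Finset.prod_erase_mul _ _ hs]
  · have h1 : (fun p : (ℕ → B) × B => Function.update p.1 s p.2) ⁻¹' (I : Set ℕ).pi t =
        (I : Set ℕ).pi t ×ˢ Set.univ := by
      ext ⟨b, x⟩
      simp only [Set.mem_preimage, Set.mem_pi, Set.mem_prod, Finset.mem_coe, Set.mem_univ,
        and_true]
      refine forall₂_congr fun i hi => ?_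
      rw [Function.update_of_ne (ne_of_mem_of_not_mem hi hs)]
    rw [h1, Measure.prod_prod, Measure.infinitePi_pi _ fun i _ => ht i, measure_univ, mul_one]

lemma lintegral_infinitePi_update (ν : Measure B) [IsProbabilityMeasure ν] (s : ℕ)
    {f : (ℕ → B) → ℝ≥0∞} (hf : Measurable f) :
    ∫⁻ b, f b ∂(Measure.infinitePi fun _ : ℕ => ν) =
      ∫⁻ b, ∫⁻ x, f (Function.update b s x) ∂ν ∂(Measure.infinitePi fun _ : ℕ => ν) := by
  have hp := measurePreserving_update_infinitePi ν s
  rw [← hp.lintegral_comp hf]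
  exact lintegral_prod _ (hf.comp hp.measurable).aemeasurable

lemma measurePreserving_prod_update_infinitePi (ζ : Measure Z) [IsProbabilityMeasure ζ]
    (ν : Measure B) [IsProbabilityMeasure ν] (s : ℕ) :
    MeasurePreserving (fun p : (Z × (ℕ → B)) × B => (p.1.1, Function.update p.1.2 s p.2))
      ((ζ.prod (Measure.infinitePi fun _ : ℕ => ν)).prod ν)
      (ζ.prod (Measure.infinitePi fun _ : ℕ => ν)) :=
  ((MeasurePreserving.id ζ).prod (measurePreserving_update_infinitePi ν s)).comp
    (measurePreserving_prodAssoc ζ (Measure.infinitePi fun _ : ℕ => ν) ν)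

/-- An event that does not depend on the outcome at `s` is independent of it. -/
lemma integral_indicator_mul_of_update_iff (ζ : Measure Z) [IsProbabilityMeasure ζ]
    (ν : Measure B) [IsProbabilityMeasure ν] (s : ℕ) {E : Set (Z × (ℕ → B))}
    (hE : MeasurableSet E)
    (hup : ∀ z b x, (z, Function.update b s x) ∈ E ↔ (z, b) ∈ E)
    {f : B → ℝ} (hf : Measurable f) :
    ∫ p, E.indicator 1 p * f (p.2 s) ∂(ζ.prod (Measure.infinitePi fun _ : ℕ => ν)) =
      (∫ p, E.indicator 1 p ∂(ζ.prod (Measure.infinitePi fun _ : ℕ => ν))) * ∫ x, f x ∂ν := by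
  have hp := measurePreserving_prod_update_infinitePi ζ ν s
  have hm : Measurable fun p : Z × (ℕ → B) => E.indicator (1 : Z × (ℕ → B) → ℝ) p * f (p.2 s) :=
    (measurable_one.indicator hE).mul
      (hf.comp ((measurable_pi_apply s).comp measurable_snd))
  rw [← integral_prod_mul (E.indicator (1 : Z × (ℕ → B) → ℝ)) f]
  -- Only the left side is written as an integral over the resampled pair; there the indicator sees
  -- the old sequence and `f` the fresh sample, so the integrand is a product.
  conv_lhs => rw [← hp.map_eq]
  rw [integral_map hp.measurable.aemeasurable hm.aestronglyMeasurable]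
  refine integral_congr_ae (Filter.Eventually.of_forall ?_)
  rintro ⟨⟨z, b⟩, x⟩
  have h1 : E.indicator (1 : Z × (ℕ → B) → ℝ) (z, Function.update b s x) =
      E.indicator 1 (z, b) := by
    by_cases h : (z, b) ∈ E
    · rw [Set.indicator_of_mem h, Set.indicator_of_mem ((hup z b x).2 h)]; rfl
    · rw [Set.indicator_of_notMem h, Set.indicator_of_notMem fun h' => h ((hup z b x).1 h')]
  simp [h1]

end Resampling

/-! ### Buffer invariants and independence of the configuration from fresh outcomes. -/

namespace QPMD

variable {A H S B : Type*} [DecidableEq A] [MeasurableSpace H] [MeasurableSpace S]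

section Feed

variable (alg : BaseAlg A H S) (h : A → B → H) (b : ℕ → B)

lemma feedOnce_of_nil {c : QPMD A S} (hc : c.queue (alg.predict c.base) = []) :
    feedOnce alg h b c = c := by
  simp [feedOnce, hc]

lemma feedOnce_of_cons {c : QPMD A S} {s : ℕ} {q : List ℕ}
    (hc : c.queue (alg.predict c.base) = s :: q) :
    feedOnce alg h b c =
      { c with
        base := alg.update c.base (h (c.past s) (b s))
        queue := Function.update c.queue (alg.predict c.base) q } := by
  simp [feedOnce, hc]

@[simp]
lemma past_feedOnce (c : QPMD A S) : (feedOnce alg h b c).past = c.past := by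
  rcases hq : c.queue (alg.predict c.base) with _ | ⟨s, q⟩
  · rw [feedOnce_of_nil alg h b hq]
  · rw [feedOnce_of_cons alg h b hq]

@[simp]
lemma past_iterate_feedOnce (m : ℕ) (c : QPMD A S) :
    ((feedOnce alg h b)^[m] c).past = c.past := by
  induction m with
  | zero => rfl
  | succ m ih => rw [Function.iterate_succ_apply', past_feedOnce, ih]

lemma queue_feedOnce_suffix (c : QPMD A S) (j : A) :
    (feedOnce alg h b c).queue j <:+ c.queue j := by
  rcases hq : c.queue (alg.predict c.base) with _ | ⟨s, q⟩
  · rw [feedOnce_of_nil alg h b hq]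
  · rw [feedOnce_of_cons alg h b hq]
    rcases eq_or_ne j (alg.predict c.base) with rfl | hj
    · simp [hq]
    · simp [Function.update_of_ne hj]

/-- Passes after the exit of the loop are idle. The number of passes, which depends on the
configuration, can thus be replaced by any upper bound. -/
lemma drain_eq_iterate [Fintype A] {c : QPMD A S} {m : ℕ} (hm : c.buffered ≤ m) :
    drain alg h b c = (feedOnce alg h b)^[m] c := by
  obtain ⟨k, rfl⟩ := Nat.exists_eq_add_of_le' hm
  rw [Function.iterate_add_apply]
  exact (Function.iterate_fixed (feedOnce_of_nil alg h b (queue_drain alg h b c)) k).symm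

end Feed

/-- The buffers at instant `t` hold, without repetition and sorted by prediction, time stamps of
feedbacks that have been revealed before `t`. -/
structure WellQueued (d : A → ℕ → ℕ) (t : ℕ) (c : QPMD A S) : Prop where
  nodup : ∀ j, (c.queue j).Nodup
  past_eq : ∀ j, ∀ s ∈ c.queue j, c.past s = j
  arrived : ∀ j, ∀ s ∈ c.queue j, s + d (c.past s) s < t

/-- The feedback of instant `s` has not been given to the base algorithm before instant `t`. -/
def Fresh (d : A → ℕ → ℕ) (t s : ℕ) (c : QPMD A S) : Prop :=
  t ≤ s + d (c.past s) s ∨ ∃ j, s ∈ c.queue j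

lemma WellQueued.feedOnce {d : A → ℕ → ℕ} {t : ℕ} {c : QPMD A S} (hc : WellQueued d t c)
    (alg : BaseAlg A H S) (h : A → B → H) (b : ℕ → B) :
    WellQueued d t (feedOnce alg h b c) where
  nodup j := (hc.nodup j).sublist (queue_feedOnce_suffix alg h b c j).sublist
  past_eq j s hs := by
    rw [past_feedOnce]
    exact hc.past_eq j s ((queue_feedOnce_suffix alg h b c j).subset hs)
  arrived j s hs := by
    rw [past_feedOnce]
    exact hc.arrived j s ((queue_feedOnce_suffix alg h b c j).subset hs)

lemma WellQueued.iterate_feedOnce {d : A → ℕ → ℕ} {t : ℕ} {c : QPMD A S}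
    (hc : WellQueued d t c) (alg : BaseAlg A H S) (h : A → B → H) (b : ℕ → B) (m : ℕ) :
    WellQueued d t ((QPMD.feedOnce alg h b)^[m] c) := by
  induction m with
  | zero => exact hc
  | succ m ih => rw [Function.iterate_succ_apply']; exact ih.feedOnce alg h b

omit [DecidableEq A] [MeasurableSpace S] in
lemma WellQueued.lt {d : A → ℕ → ℕ} {t : ℕ} {c : QPMD A S} (hc : WellQueued d t c) {j : A}
    {s : ℕ} (hs : s ∈ c.queue j) : s < t :=
  (Nat.le_add_right _ _).trans_lt (hc.arrived j s hs)

omit [MeasurableSpace S] in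
-- The buffers are disjoint sets of instants before `t`. At instant `t` the loop is therefore the
-- same as `t` passes, a number that does not depend on the outcomes.
lemma WellQueued.buffered_le [Fintype A] {d : A → ℕ → ℕ} {t : ℕ} {c : QPMD A S}
    (hc : WellQueued d t c) : c.buffered ≤ t := by
  calc c.buffered = ∑ j, (c.queue j).toFinset.card :=
        Finset.sum_congr rfl fun j _ => (List.toFinset_card_of_nodup (hc.nodup j)).symm
    _ ≤ ∑ j, ((Finset.range t).filter fun s => c.past s = j).card := by
        refine Finset.sum_le_sum fun j _ => Finset.card_le_card fun s hs => ?_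
        rw [List.mem_toFinset] at hs
        simpa using ⟨hc.lt hs, hc.past_eq j s hs⟩
    _ = t := by
        rw [← Finset.card_eq_sum_card_fiberwise (fun _ _ => Finset.mem_coe.2 (Finset.mem_univ _)),
          Finset.card_range]

/-- Freshness propagates backwards in time because a pass only shrinks the buffers. -/
lemma Fresh.of_feedOnce {d : A → ℕ → ℕ} {t s : ℕ} {c : QPMD A S} {alg : BaseAlg A H S}
    {h : A → B → H} {b : ℕ → B} (hs : Fresh d t s (feedOnce alg h b c)) : Fresh d t s c := by
  rcases hs with hs | ⟨j, hs⟩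
  · left; simpa using hs
  · exact Or.inr ⟨j, (queue_feedOnce_suffix alg h b c j).subset hs⟩

/-- The feedback that is given to the base algorithm is no longer fresh. -/
lemma WellQueued.feedOnce_update {d : A → ℕ → ℕ} {t s : ℕ} {c : QPMD A S}
    (hc : WellQueued d t c) {alg : BaseAlg A H S} {h : A → B → H} {b : ℕ → B}
    (hs : Fresh d t s (QPMD.feedOnce alg h b c)) (y : B) :
    QPMD.feedOnce alg h (Function.update b s y) c = QPMD.feedOnce alg h b c := by
  rcases hq : c.queue (alg.predict c.base) with _ | ⟨s', q⟩
  · rw [feedOnce_of_nil _ _ _ hq, feedOnce_of_nil _ _ _ hq]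
  · have hmem : s' ∈ c.queue (alg.predict c.base) := by simp [hq]
    have hne : s' ≠ s := by
      rintro rfl
      rcases hs with hs | ⟨j, hs⟩
      -- A popped stamp was revealed before `t`, so it cannot be one that is still to be revealed.
      · rw [past_feedOnce] at hs
        exact absurd (hc.arrived _ _ hmem) (not_lt.2 hs)
      -- Nor can it remain buffered: it belongs only to the buffer of its own prediction, where it
      -- occurred once, at the head.
      · have hj := hc.past_eq _ _ ((queue_feedOnce_suffix alg h b c j).subset hs)
        rw [hc.past_eq _ _ hmem] at hj
        subst hj
        rw [feedOnce_of_cons _ _ _ hq] at hs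
        have hnd := hc.nodup (alg.predict c.base)
        rw [hq, List.nodup_cons] at hnd
        exact hnd.1 (by simpa using hs)
    rw [feedOnce_of_cons _ _ _ hq, feedOnce_of_cons _ _ _ hq, Function.update_of_ne hne]

lemma enqueue_apply (past : ℕ → A) (l : List ℕ) (Q : A → List ℕ) (j : A) :
    enqueue past Q l j = Q j ++ l.filter fun s => past s = j := by
  induction l generalizing Q with
  | nil => simp [enqueue]
  | cons s l ih =>
    have h1 : enqueue past Q (s :: l) =
      enqueue past (Function.update Q (past s) (Q (past s) ++ [s])) l := rfl
    rw [h1, ih]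
    by_cases hj : past s = j
    · subst hj; simp
    · simp [Function.update_of_ne (Ne.symm hj), hj]

omit [DecidableEq A] in
lemma mem_arrivals {d : A → ℕ → ℕ} {past : ℕ → A} {t s : ℕ} :
    s ∈ arrivals d past t ↔ s + d (past s) s = t := by
  simp only [arrivals, Finset.mem_filter, Finset.mem_range, and_iff_right_iff_imp]
  omega

section Run

variable [Fintype A] (alg : BaseAlg A H S) (h : A → B → H) {order : ℕ → Finset ℕ → List ℕ}
  (horder : ∀ t F, (order t F : Multiset ℕ) = F.val) (d : A → ℕ → ℕ) (b : ℕ → B)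

include horder in
lemma mem_order {t s : ℕ} {F : Finset ℕ} : s ∈ order t F ↔ s ∈ F := by
  rw [← Multiset.mem_coe, horder, Finset.mem_val]

include horder in
lemma nodup_order (t : ℕ) (F : Finset ℕ) : (order t F).Nodup := by
  rw [← Multiset.coe_nodup, horder]; exact F.nodup

include horder in
lemma length_filter_order (t : ℕ) (F : Finset ℕ) (p : ℕ → Prop) [DecidablePred p] :
    ((order t F).filter fun s => p s).length = (F.filter p).card := by
  rw [Finset.card_def, Finset.filter_val, ← horder t F, Multiset.filter_coe, Multiset.coe_card]

include horder in
lemma WellQueued.step {t : ℕ} {c : QPMD A S} (hc : WellQueued d t c) :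
    WellQueued d (t + 1) (step alg h order d b t c) := by
  have hd := hc.iterate_feedOnce alg h b c.buffered
  change WellQueued d t (drain alg h b c) at hd
  set c' := drain alg h b c with hc'
  set past' := Function.update c'.past t (alg.predict c'.base) with hp
  have hpast : ∀ {j s}, s ∈ c'.queue j → past' s = c'.past s := fun hs =>
    Function.update_of_ne (hd.lt hs).ne _ _
  have hq : ∀ j, (QPMD.step alg h order d b t c).queue j =
      c'.queue j ++ (order t (arrivals d past' t)).filter fun s => past' s = j :=
    fun j => enqueue_apply _ _ _ _
  have hp' : (QPMD.step alg h order d b t c).past = past' := rfl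
  refine ⟨fun j => ?_, fun j s hs => ?_, fun j s hs => ?_⟩
  · rw [hq, List.nodup_append']
    refine ⟨hd.nodup j, (nodup_order horder _ _).filter _, ?_⟩
    -- Old entries were revealed strictly before `t`, new ones exactly at `t`.
    intro s hs hs'
    have h1 := hd.arrived j s hs
    have h2 := List.mem_of_mem_filter hs'
    rw [mem_order horder, mem_arrivals, hpast hs] at h2
    omega
  · rw [hp']
    rw [hq, List.mem_append] at hs
    rcases hs with hs | hs
    · rw [hpast hs, hd.past_eq j s hs]
    · simpa using (List.mem_filter.1 hs).2
  · rw [hp']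
    rw [hq, List.mem_append] at hs
    rcases hs with hs | hs
    · rw [hpast hs]; exact (hd.arrived j s hs).trans (Nat.lt_succ_self t)
    · have h2 := List.mem_of_mem_filter hs
      rw [mem_order horder, mem_arrivals] at h2
      omega

include horder in
lemma wellQueued_run (s₀ : S) (t : ℕ) : WellQueued d t (run alg h order d b s₀ t) := by
  induction t with
  | zero => exact ⟨fun _ => by simp [run], fun _ _ hs => by simp [run] at hs,
      fun _ _ hs => by simp [run] at hs⟩
  | succ t ih => exact ih.step alg h horder d b

include horder in
lemma Fresh.of_step {t s : ℕ} {c : QPMD A S}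
    (hs : Fresh d (t + 1) s (step alg h order d b t c)) :
    Fresh d t s (drain alg h b c) := by
  set c' := drain alg h b c with hc'
  set past' := Function.update c'.past t (alg.predict c'.base) with hp
  have key : t ≤ s + d (past' s) s → t ≤ s + d (c'.past s) s := by
    -- The record `past` changes only at `t`, and the feedback of instant `t` is never revealed
    -- before `t`, whatever its delay.
    rcases eq_or_ne s t with rfl | hst
    · intro _; omega
    · rw [hp, Function.update_of_ne hst]; exact id
  rcases hs with hs | ⟨j, hs⟩
  · exact Or.inl (key (by change t + 1 ≤ s + d (past' s) s at hs; omega))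
  · change s ∈ enqueue past' c'.queue (order t (arrivals d past' t)) j at hs
    rw [enqueue_apply, List.mem_append] at hs
    rcases hs with hs | hs
    · exact Or.inr ⟨j, hs⟩
    · have h2 := List.mem_of_mem_filter hs
      rw [mem_order horder, mem_arrivals] at h2
      exact Or.inl (key h2.ge)

include horder in
/-- The configuration does not depend on the outcomes of instants whose feedback is fresh. -/
lemma iterate_feedOnce_run_update (s₀ : S) (s : ℕ) (y : B) (t m : ℕ)
    (hs : Fresh d t s ((feedOnce alg h b)^[m] (run alg h order d b s₀ t))) :
    (feedOnce alg h (Function.update b s y))^[m] (run alg h order d (Function.update b s y) s₀ t) =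
      (feedOnce alg h b)^[m] (run alg h order d b s₀ t) := by
  induction t generalizing m with
  | zero =>
    induction m with
    | zero => rfl
    | succ m ih =>
      rw [Function.iterate_succ_apply'] at hs
      rw [Function.iterate_succ_apply', Function.iterate_succ_apply', ih hs.of_feedOnce,
        ((wellQueued_run alg h horder d b s₀ 0).iterate_feedOnce alg h b m).feedOnce_update hs]
  | succ t iht =>
    induction m with
    | zero =>
      have h1 := iht _ (Fresh.of_step alg h horder d b hs)
      have h2 := iht 0
      simp only [Function.iterate_zero, id_eq] at h2 ⊢
      -- The pass count `buffered` inside `drain` is itself a function of the outcomes. Freshness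
      -- before the loop first identifies the two starting configurations, hence the two pass
      -- counts; then `h1` compares the loops.
      have h3 : Fresh d t s (run alg h order d b s₀ t) := by
        have h4 := Fresh.of_step alg h horder d b hs
        rw [drain] at h4
        generalize (run alg h order d b s₀ t).buffered = k at h4
        induction k with
        | zero => exact h4
        | succ k ihk => rw [Function.iterate_succ_apply'] at h4; exact ihk h4.of_feedOnce
      have h5 : drain alg h (Function.update b s y)
          (run alg h order d (Function.update b s y) s₀ t) =
          drain alg h b (run alg h order d b s₀ t) := by
        rw [drain, h2 h3]
        rw [h2 h3] at h1
        exact h1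
      change step alg h order d _ t _ = step alg h order d _ t _
      simp only [step, h5]
    | succ m ih =>
      rw [Function.iterate_succ_apply'] at hs
      rw [Function.iterate_succ_apply', Function.iterate_succ_apply', ih hs.of_feedOnce,
        ((wellQueued_run alg h horder d b s₀ (t + 1)).iterate_feedOnce alg h b m).feedOnce_update
          hs]

include horder in
lemma drain_run_eq_iterate (s₀ : S) (t : ℕ) :
    drain alg h b (run alg h order d b s₀ t) =
      (feedOnce alg h b)^[t] (run alg h order d b s₀ t) :=
  drain_eq_iterate alg h b (wellQueued_run alg h horder d b s₀ t).buffered_le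

include horder in
/-- The prediction of instant `t` does not depend on the outcome of instant `t`. -/
lemma action_update (s₀ : S) (t : ℕ) (y : B) :
    action alg h order d (Function.update b t y) s₀ t = action alg h order d b s₀ t := by
  -- At instant `t` the stamp `t` is fresh, since its feedback is revealed at `t` or later.
  rw [action, action, drain_run_eq_iterate alg h horder, drain_run_eq_iterate alg h horder,
    iterate_feedOnce_run_update alg h horder d b s₀ t y t t (Or.inl (Nat.le_add_right _ _))]

lemma past_run (s₀ : S) {s t : ℕ} (hst : s < t) :
    (run alg h order d b s₀ t).past s = action alg h order d b s₀ s := by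
  induction t with
  | zero => omega
  | succ t ih =>
    change Function.update (drain alg h b (run alg h order d b s₀ t)).past t
      (action alg h order d b s₀ t) s = _
    rcases eq_or_ne s t with rfl | hne
    · simp
    · rw [Function.update_of_ne hne, drain, past_iterate_feedOnce, ih (by omega)]

include horder in
-- What instant `t` appends to `Q[j]` is exactly the increment of `S_j`; the sums on both sides
-- avoid truncated subtraction.
lemma length_queue_run_succ (s₀ : S) (t : ℕ) (j : A) :
    ((run alg h order d b s₀ (t + 1)).queue j).length +
        numReceived d (action alg h order d b s₀) j t =
      ((drain alg h b (run alg h order d b s₀ t)).queue j).length +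
        numReceived d (action alg h order d b s₀) j (t + 1) := by
  have hp : ∀ s < t + 1, (run alg h order d b s₀ (t + 1)).past s = action alg h order d b s₀ s :=
    fun s hs => past_run alg h d b s₀ hs
  have h1 : (run alg h order d b s₀ (t + 1)).queue j =
      (drain alg h b (run alg h order d b s₀ t)).queue j ++
        (order t (arrivals d (run alg h order d b s₀ (t + 1)).past t)).filter
          fun s => (run alg h order d b s₀ (t + 1)).past s = j := enqueue_apply _ _ _ _
  rw [h1, List.length_append, length_filter_order horder]
  generalize (run alg h order d b s₀ (t + 1)).past = past at hp
  generalize action alg h order d b s₀ = a at hp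
  have h2 : numReceived d a j (t + 1) =
      numReceived d a j t + ((arrivals d past t).filter fun s => past s = j).card := by
    rw [numReceived, numReceived, ← Finset.card_union_of_disjoint]
    · congr 1
      ext s
      simp only [Finset.mem_filter, Finset.mem_union, Finset.mem_range, mem_arrivals]
      constructor
      · rintro ⟨h3, h4, h5⟩
        rw [hp s h3]
        by_cases h6 : s + d (a s) s = t
        · exact Or.inr ⟨h6, h4⟩
        · exact Or.inl ⟨by omega, h4, by omega⟩
      · rintro (⟨h3, h4, h5⟩ | ⟨h3, h4⟩)
        · exact ⟨by omega, h4, by omega⟩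
        · have h6 : s < t + 1 := by omega
          rw [hp s h6] at h3 h4
          exact ⟨h6, h4, by omega⟩
    · rw [Finset.disjoint_left]
      intro s hs hs'
      simp only [Finset.mem_filter, Finset.mem_range, mem_arrivals] at hs hs'
      rw [hp s (by omega)] at hs'
      omega
  omega

end Run

end QPMD

/-! ### Measurability of maps into countable sets without a σ-algebra. -/

section MeasurableFibers

variable {X K L Y : Type*} [MeasurableSpace X] [MeasurableSpace Y]

/-- All fibers of `k` are measurable; for countable `K` this is measurability with respect to the
discrete σ-algebra. -/
def MeasurableFibers (k : X → K) : Prop := ∀ q, MeasurableSet (k ⁻¹' {q})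

/-- Partition the space by the countably many values of `k`. This is how random predictions, buffers
and pass counts are frozen in measurability proofs. -/
lemma MeasurableFibers.measurable_comp₂ [Countable K] {k : X → K} (hk : MeasurableFibers k)
    {g : K → X → Y} (hg : ∀ q, Measurable (g q)) : Measurable fun x => g (k x) x := by
  intro s hs
  have h1 : (fun x => g (k x) x) ⁻¹' s = ⋃ q, k ⁻¹' {q} ∩ g q ⁻¹' s := by
    ext x; simp
  rw [h1]
  exact .iUnion fun q => (hk q).inter (hg q hs)

lemma MeasurableFibers.comp₂ [Countable K] {k : X → K} (hk : MeasurableFibers k)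
    {g : K → X → L} (hg : ∀ q, MeasurableFibers (g q)) :
    MeasurableFibers fun x => g (k x) x := by
  intro l
  have h1 : (fun x => g (k x) x) ⁻¹' {l} = ⋃ q, k ⁻¹' {q} ∩ g q ⁻¹' {l} := by
    ext x; simp
  rw [h1]
  exact .iUnion fun q => (hk q).inter (hg q l)

lemma measurableFibers_const (l : L) : MeasurableFibers fun _ : X => l := fun q =>
  measurable_const_set l q
where
  measurable_const_set (l q : L) : MeasurableSet ((fun _ : X => l) ⁻¹' {q}) := by
    by_cases h : l = q <;> simp [h]

lemma MeasurableFibers.comp [Countable K] {k : X → K} (hk : MeasurableFibers k) (f : K → L) :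
    MeasurableFibers fun x => f (k x) :=
  hk.comp₂ (g := fun q _ => f q) fun q => measurableFibers_const (f q)

lemma MeasurableFibers.prodMk {k : X → K} (hk : MeasurableFibers k) {l : X → L}
    (hl : MeasurableFibers l) : MeasurableFibers fun x => (k x, l x) := by
  rintro ⟨p, q⟩
  have h1 : (fun x => (k x, l x)) ⁻¹' {(p, q)} = k ⁻¹' {p} ∩ l ⁻¹' {q} := by ext x; simp
  rw [h1]
  exact (hk p).inter (hl q)

lemma MeasurableFibers.measurable_comp [Countable K] {k : X → K} (hk : MeasurableFibers k)
    (f : K → Y) : Measurable fun x => f (k x) :=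
  hk.measurable_comp₂ (g := fun q _ => f q) fun _ => measurable_const

lemma Measurable.measurableFibers [MeasurableSingletonClass Y] {f : X → Y} (hf : Measurable f) :
    MeasurableFibers f := fun q => hf (measurableSet_singleton q)

lemma measurableFibers_filter (F : Finset ℕ) {p : X → ℕ → Prop} [∀ x, DecidablePred (p x)]
    (hp : ∀ s, MeasurableSet {x | p x s}) : MeasurableFibers fun x => F.filter (p x) := by
  intro G
  by_cases hG : G ⊆ F
  · have h1 : (fun x => F.filter (p x)) ⁻¹' {G} = ⋂ s ∈ F, {x | p x s ↔ s ∈ G} := by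
      ext x
      simp only [Set.mem_preimage, Set.mem_singleton_iff, Set.mem_iInter, Set.mem_ofPred_eq,
        Finset.ext_iff, Finset.mem_filter]
      constructor
      · intro H s hs
        rw [← H s]; simp [hs]
      · intro H s
        constructor
        · rintro ⟨hs, h2⟩; exact (H s hs).1 h2
        · intro hs; exact ⟨hG hs, (H s (hG hs)).2 hs⟩
    rw [h1]
    refine F.measurableSet_biInter fun s _ => ?_
    by_cases hs : s ∈ G
    · simpa [hs] using hp s
    · simp only [hs, iff_false]
      exact (hp s).compl
  · have h1 : (fun x => F.filter (p x)) ⁻¹' {G} = ∅ := by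
      ext x
      simp only [Set.mem_preimage, Set.mem_singleton_iff, Set.mem_empty_iff_false, iff_false]
      rintro rfl
      exact hG (Finset.filter_subset _ _)
    rw [h1]
    exact .empty

end MeasurableFibers

/-! ### Measurability of the trajectories and counts. -/

namespace BaseAlg

variable {A H S B X : Type*} [MeasurableSpace H] [MeasurableSpace S] [MeasurableSpace B]
  [MeasurableSpace X]

lemma measurableFibers_predict (alg : BaseAlg A H S) {f : X → S} (hf : Measurable f) :
    MeasurableFibers fun x => alg.predict (f x) := fun i => hf (alg.measurableSet_predict i)

lemma measurable_update_comp [Countable A] (alg : BaseAlg A H S) {h : A → B → H}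
    (hh : ∀ i, Measurable (h i)) {f : X → S} (hf : Measurable f) {a : X → A}
    (ha : MeasurableFibers a) {y : X → B} (hy : Measurable y) :
    Measurable fun x => alg.update (f x) (h (a x) (y x)) :=
  ha.measurable_comp₂ (g := fun i x => alg.update (f x) (h i (y x))) fun i =>
    alg.measurable_update.comp (hf.prodMk ((hh i).comp hy))

lemma measurable_run [Countable A] (alg : BaseAlg A H S) {h : A → B → H}
    (hh : ∀ i, Measurable (h i)) {b : X → ℕ → B} (hb : Measurable b) {s₀ : X → S}
    (hs₀ : Measurable s₀) (t : ℕ) : Measurable fun x => alg.run h (b x) (s₀ x) t := by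
  induction t with
  | zero => exact hs₀
  | succ t ih =>
    exact alg.measurable_update_comp hh ih (alg.measurableFibers_predict ih)
      ((measurable_pi_apply t).comp hb)

lemma measurableFibers_action [Countable A] (alg : BaseAlg A H S) {h : A → B → H}
    (hh : ∀ i, Measurable (h i)) {b : X → ℕ → B} (hb : Measurable b) {s₀ : X → S}
    (hs₀ : Measurable s₀) (t : ℕ) : MeasurableFibers fun x => alg.action h (b x) (s₀ x) t :=
  alg.measurableFibers_predict (alg.measurable_run hh hb hs₀ t)

end BaseAlg

namespace QPMD

variable {A H S B X : Type*} [MeasurableSpace H] [MeasurableSpace S]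
  [MeasurableSpace B] [MeasurableSpace X]

/-- Measurability of a random configuration, componentwise. -/
structure IsMeasurable (c : X → QPMD A S) : Prop where
  base : Measurable fun x => (c x).base
  queue : MeasurableFibers fun x => (c x).queue
  past : ∀ s, MeasurableFibers fun x => (c x).past s

variable [DecidableEq A] [Fintype A] (alg : BaseAlg A H S) {h : A → B → H}
  (hh : ∀ i, Measurable (h i)) {b : X → ℕ → B} (hb : Measurable b)

include hh hb

lemma IsMeasurable.feedOnce {c : X → QPMD A S} (hc : IsMeasurable c) :
    IsMeasurable fun x => feedOnce alg h (b x) (c x) := by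
  have hk := (alg.measurableFibers_predict hc.base).prodMk hc.queue
  refine ⟨?_, ?_, fun s => by simpa using hc.past s⟩
  · let g : A × (A → List ℕ) → X → S := fun k x => match k.2 k.1 with
      | [] => (c x).base
      | s :: _ => alg.update (c x).base (h ((c x).past s) (b x s))
    have h1 : (fun x => (QPMD.feedOnce alg h (b x) (c x)).base) =
        fun x => g (alg.predict (c x).base, (c x).queue) x := by
      funext x
      rcases hq : (c x).queue (alg.predict (c x).base) with _ | ⟨s, q⟩ <;>
        simp [QPMD.feedOnce, g, hq]
    rw [h1]
    refine hk.measurable_comp₂ fun k => ?_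
    rcases hq : k.2 k.1 with _ | ⟨s, q⟩
    · simpa [g, hq] using hc.base
    · simpa [g, hq] using alg.measurable_update_comp hh hc.base (hc.past s)
        ((measurable_pi_apply s).comp hb)
  · let g : A × (A → List ℕ) → A → List ℕ := fun k => match k.2 k.1 with
      | [] => k.2
      | _ :: q => Function.update k.2 k.1 q
    have h1 : (fun x => (QPMD.feedOnce alg h (b x) (c x)).queue) =
        fun x => g (alg.predict (c x).base, (c x).queue) := by
      funext x
      rcases hq : (c x).queue (alg.predict (c x).base) with _ | ⟨s, q⟩ <;>
        simp [QPMD.feedOnce, g, hq]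
    rw [h1]
    exact hk.comp g

lemma IsMeasurable.iterate_feedOnce {c : X → QPMD A S} (hc : IsMeasurable c) (m : ℕ) :
    IsMeasurable fun x => (QPMD.feedOnce alg h (b x))^[m] (c x) := by
  induction m with
  | zero => exact hc
  | succ m ih =>
    simp only [Function.iterate_succ_apply']
    exact ih.feedOnce alg hh hb

lemma IsMeasurable.drain {c : X → QPMD A S} (hc : IsMeasurable c) :
    IsMeasurable fun x => drain alg h (b x) (c x) := by
  have hk : MeasurableFibers fun x => (c x).buffered :=
    hc.queue.comp fun Q => ∑ i, (Q i).length
  have hi := hc.iterate_feedOnce alg hh hb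
  exact ⟨hk.measurable_comp₂ (g := fun m x => ((QPMD.feedOnce alg h (b x))^[m] (c x)).base)
      fun m => (hi m).base,
    hk.comp₂ (g := fun m x => ((QPMD.feedOnce alg h (b x))^[m] (c x)).queue)
      fun m => (hi m).queue,
    fun s => hk.comp₂ (g := fun m x => ((QPMD.feedOnce alg h (b x))^[m] (c x)).past s)
      fun m => (hi m).past s⟩

omit hh hb [MeasurableSpace H] [MeasurableSpace S] [MeasurableSpace B] in
lemma measurableFibers_enqueue {past : X → ℕ → A} (hp : ∀ s, MeasurableFibers fun x => past x s)
    (l : List ℕ) {Q : X → A → List ℕ} (hQ : MeasurableFibers Q) :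
    MeasurableFibers fun x => enqueue (past x) (Q x) l := by
  induction l generalizing Q with
  | nil => exact hQ
  | cons s l ih =>
    exact ih ((hQ.prodMk (hp s)).comp fun k => Function.update k.1 k.2 (k.1 k.2 ++ [s]))

lemma IsMeasurable.step {c : X → QPMD A S} (hc : IsMeasurable c)
    (order : ℕ → Finset ℕ → List ℕ) {d : X → A → ℕ → ℕ} (hd : Measurable d) (t : ℕ) :
    IsMeasurable fun x => step alg h order (d x) (b x) t (c x) := by
  have hc' := hc.drain alg hh hb
  have hp : ∀ s, MeasurableFibers fun x => Function.update (QPMD.drain alg h (b x) (c x)).past t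
      (alg.predict (QPMD.drain alg h (b x) (c x)).base) s := by
    intro s
    rcases eq_or_ne s t with rfl | hs
    · simpa using alg.measurableFibers_predict hc'.base
    · simpa [Function.update_of_ne hs] using hc'.past s
  refine ⟨hc'.base, ?_, hp⟩
  have hF : MeasurableFibers fun x => arrivals (d x)
      (Function.update (QPMD.drain alg h (b x) (c x)).past t
        (alg.predict (QPMD.drain alg h (b x) (c x)).base)) t := by
    refine measurableFibers_filter _ fun s => ?_
    refine (((hp s).comp₂ (g := fun i x => d x i s) fun i => Measurable.measurableFibers ?_).comp
      (fun m => s + m)) t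
    fun_prop
  exact hF.comp₂ (g := fun F x => enqueue (Function.update (QPMD.drain alg h (b x) (c x)).past t
        (alg.predict (QPMD.drain alg h (b x) (c x)).base)) (QPMD.drain alg h (b x) (c x)).queue
          (order t F)) fun F => measurableFibers_enqueue hp _ hc'.queue

lemma isMeasurable_run (order : ℕ → Finset ℕ → List ℕ) {d : X → A → ℕ → ℕ} (hd : Measurable d)
    {s₀ : X → S} (hs₀ : Measurable s₀) (t : ℕ) :
    IsMeasurable fun x => run alg h order (d x) (b x) (s₀ x) t := by
  induction t with
  | zero => exact ⟨hs₀, measurableFibers_const _, fun _ => alg.measurableFibers_predict hs₀⟩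
  | succ t ih => exact ih.step alg hh hb order hd t

lemma measurableFibers_action (order : ℕ → Finset ℕ → List ℕ) {d : X → A → ℕ → ℕ}
    (hd : Measurable d) {s₀ : X → S} (hs₀ : Measurable s₀) (t : ℕ) :
    MeasurableFibers fun x => action alg h order (d x) (b x) (s₀ x) t :=
  alg.measurableFibers_predict ((isMeasurable_run alg hh hb order hd hs₀ t).drain alg hh hb).base

end QPMD

section Counts

variable {A X : Type*} [DecidableEq A] [MeasurableSpace X] {a : X → ℕ → A}

lemma measurable_numPred (ha : ∀ t, MeasurableFibers fun x => a x t) (i : A) (t : ℕ) :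
    Measurable fun x => numPred (a x) i t :=
  (measurableFibers_filter (Finset.range t) (p := fun x s => a x s = i)
    fun s => ha s i).measurable_comp Finset.card

lemma measurable_maxMissing [Countable A] {d : X → A → ℕ → ℕ} (hd : Measurable d)
    (ha : ∀ t, MeasurableFibers fun x => a x t) (i : A) (n : ℕ) :
    Measurable fun x => maxMissing (d x) (a x) i n := by
  have h1 : ∀ t, Measurable fun x => numReceived (d x) (a x) i t := by
    intro t
    refine (measurableFibers_filter (Finset.range t)
      (p := fun x s => a x s = i ∧ s + d x (a x s) s < t) fun s => ?_).measurable_comp Finset.card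
    refine (ha s i).inter ?_
    have h2 : Measurable fun x => d x (a x s) s :=
      (ha s).measurable_comp₂ (g := fun i x => d x i s) fun i => by fun_prop
    exact measurableSet_lt (measurable_const.add h2) measurable_const
  have h3 : ∀ t, Measurable fun x => numMissing (d x) (a x) i t := fun t =>
    ((measurable_numPred ha i t).measurableFibers.prodMk (h1 t).measurableFibers).measurable_comp
      fun k => k.1 - k.2
  unfold maxMissing
  induction n with
  | zero => simp
  | succ n ih =>
    simp only [Finset.range_add_one, Finset.sup_insert]
    exact ((h3 n).measurableFibers.prodMk ih.measurableFibers).measurable_comp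
      fun k => k.1 ⊔ k.2

end Counts

/-! ### Harmonic functions of the base state keep their expectation with and without delays. -/

section Harmonic

variable {A H S B : Type*} [MeasurableSpace H] [MeasurableSpace S] [MeasurableSpace B]

/-- `ψ` is a function of the state whose expectation is preserved by a step of the algorithm when
the outcome has distribution `ν`. -/
def BaseAlg.IsHarmonic (alg : BaseAlg A H S) (h : A → B → H) (ν : Measure B) (ψ : S → ℝ≥0∞) :
    Prop :=
  ∀ x, ∫⁻ y, ψ (alg.update x (h (alg.predict x) y)) ∂ν = ψ x

namespace BaseAlg

variable {alg : BaseAlg A H S} {h : A → B → H} {ν : Measure B} [IsProbabilityMeasure ν]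
  {ψ : S → ℝ≥0∞}

/-- Resample `b s`: on `E` neither the event nor the state `x` reacts, so the inner integral is the
harmonicity identity at `x b`. -/
lemma IsHarmonic.setLIntegral_update [Countable A] (hψ : alg.IsHarmonic h ν ψ)
    (hψm : Measurable ψ) (hh : ∀ i, Measurable (h i)) {x : (ℕ → B) → S} (hx : Measurable x)
    (s : ℕ) {E : Set (ℕ → B)} (hE : MeasurableSet E)
    (hup : ∀ b ∈ E, ∀ y, Function.update b s y ∈ E ∧ x (Function.update b s y) = x b) :
    ∫⁻ b in E, ψ (alg.update (x b) (h (alg.predict (x b)) (b s)))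
        ∂(Measure.infinitePi fun _ : ℕ => ν) =
      ∫⁻ b in E, ψ (x b) ∂(Measure.infinitePi fun _ : ℕ => ν) := by
  have hm : Measurable fun b => ψ (alg.update (x b) (h (alg.predict (x b)) (b s))) :=
    hψm.comp (alg.measurable_update_comp hh hx (alg.measurableFibers_predict hx)
      (measurable_pi_apply s))
  rw [← lintegral_indicator hE, ← lintegral_indicator hE,
    lintegral_infinitePi_update ν s (hm.indicator hE)]
  refine lintegral_congr fun b => ?_
  by_cases hb : b ∈ E
  · simp only [Set.indicator_of_mem (hup b hb _).1, Set.indicator_of_mem hb, (hup b hb _).2,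
      Function.update_self]
    exact hψ (x b)
  -- Outside `E` too: restoring the coordinate `s` would bring the sequence back into `E`.
  · have h1 : ∀ y, Function.update b s y ∉ E := fun y hy => hb (by
      simpa using (hup _ hy (b s)).1)
    simp [Set.indicator_of_notMem hb, Set.indicator_of_notMem (h1 _)]

omit [MeasurableSpace B] in
lemma run_update (s₀ : S) (b : ℕ → B) (y : B) {s t : ℕ} (hst : t ≤ s) :
    alg.run h (Function.update b s y) s₀ t = alg.run h b s₀ t := by
  induction t with
  | zero => rfl
  | succ t ih =>
    have hne : t ≠ s := by omega
    simp only [run, ih (by omega), Function.update_of_ne hne]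

omit [MeasurableSpace B] in
lemma action_update (s₀ : S) (b : ℕ → B) (y : B) (t : ℕ) :
    alg.action h (Function.update b t y) s₀ t = alg.action h b s₀ t := by
  rw [action, action, run_update s₀ b y le_rfl]

lemma IsHarmonic.lintegral_run [Countable A] (hψ : alg.IsHarmonic h ν ψ) (hψm : Measurable ψ)
    (hh : ∀ i, Measurable (h i)) (s₀ : S) (t : ℕ) :
    ∫⁻ b, ψ (alg.run h b s₀ t) ∂(Measure.infinitePi fun _ : ℕ => ν) = ψ s₀ := by
  induction t with
  | zero => simp [run]
  | succ t ih =>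
    rw [← ih]
    simpa [run] using hψ.setLIntegral_update hψm hh
      (alg.measurable_run hh measurable_id measurable_const t) t .univ
      fun b _ y => ⟨trivial, run_update s₀ b y le_rfl⟩

end BaseAlg

namespace QPMD

variable [DecidableEq A] [Fintype A] {alg : BaseAlg A H S} {h : A → B → H} {ν : Measure B}
  [IsProbabilityMeasure ν] {ψ : S → ℝ≥0∞}

/-- The popped stamp depends on the outcomes, so the space is split according to it. On the piece
with stamp `s`, that stamp is still buffered before the pass, so neither the piece nor the state
depends on `b s`, and one harmonic step applies. -/
lemma lintegral_iterate_feedOnce_succ (hψ : alg.IsHarmonic h ν ψ) (hψm : Measurable ψ)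
    (hh : ∀ i, Measurable (h i)) {order : ℕ → Finset ℕ → List ℕ}
    (horder : ∀ t F, (order t F : Multiset ℕ) = F.val) (d : A → ℕ → ℕ) (s₀ : S) (t m : ℕ) :
    ∫⁻ b, ψ ((feedOnce alg h b)^[m + 1] (run alg h order d b s₀ t)).base
        ∂(Measure.infinitePi fun _ : ℕ => ν) =
      ∫⁻ b, ψ ((feedOnce alg h b)^[m] (run alg h order d b s₀ t)).base
        ∂(Measure.infinitePi fun _ : ℕ => ν) := by
  simp only [Function.iterate_succ_apply']
  have hup := fun b s y => iterate_feedOnce_run_update alg h horder d b s₀ s y t m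
  have hw := fun b => (wellQueued_run alg h horder d b s₀ t).iterate_feedOnce alg h b m
  have hc : IsMeasurable fun b : ℕ → B => (feedOnce alg h b)^[m] (run alg h order d b s₀ t) :=
    (isMeasurable_run alg hh measurable_id order measurable_const measurable_const t).iterate_feedOnce
      alg hh measurable_id m
  generalize hcd : (fun b : ℕ → B => (feedOnce alg h b)^[m] (run alg h order d b s₀ t)) = c at *
  have hcd' : ∀ b, (feedOnce alg h b)^[m] (run alg h order d b s₀ t) = c b := fun b => by
    rw [← hcd]
  simp only [hcd'] at hup hw ⊢
  -- `none` is the event that the pass is idle, `some s` the event that it pops `s`.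
  set E : Option ℕ → Set (ℕ → B) := fun o =>
    {b | ((c b).queue (alg.predict (c b).base)).head? = o} with hE
  have hEm : ∀ o, MeasurableSet (E o) :=
    ((alg.measurableFibers_predict hc.base).prodMk hc.queue).comp fun k => (k.2 k.1).head?
  have hdisj : Pairwise (Function.onFun Disjoint E) := by
    intro o o' hne
    refine Set.disjoint_left.2 fun b hb hb' => hne ?_
    exact (show _ = o from hb).symm.trans hb'
  have hcov : ⋃ o, E o = Set.univ := by ext b; simp [hE]
  rw [← setLIntegral_univ, ← setLIntegral_univ fun b => ψ (c b).base, ← hcov,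
    lintegral_iUnion hEm hdisj, lintegral_iUnion hEm hdisj]
  refine tsum_congr fun o => ?_
  rcases o with _ | s
  · refine setLIntegral_congr_fun (hEm _) fun b hb => ?_
    have hq : (c b).queue (alg.predict (c b).base) = [] := List.head?_eq_none_iff.1 hb
    simp only [feedOnce_of_nil alg h b hq]
  · rw [← hψ.setLIntegral_update hψm hh hc.base s (hEm (some s))]
    · refine setLIntegral_congr_fun (hEm _) fun b hb => ?_
      obtain ⟨q, hq⟩ : ∃ q, (c b).queue (alg.predict (c b).base) = s :: q :=
        List.head?_eq_some_iff.1 hb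
      simp only [feedOnce_of_cons alg h b hq, (hw b).past_eq _ s (by rw [hq]; simp)]
    · intro b hb y
      obtain ⟨q, hq⟩ : ∃ q, (c b).queue (alg.predict (c b).base) = s :: q :=
        List.head?_eq_some_iff.1 hb
      have h1 := hup b s y (Or.inr ⟨_, by rw [hq]; simp⟩)
      exact ⟨by simpa only [hE, Set.mem_ofPred_eq, h1] using hb, by rw [h1]⟩

/-- The base algorithm cannot tell the feedbacks that it receives through the buffers from those of
the environment without delays. -/
lemma lintegral_run (hψ : alg.IsHarmonic h ν ψ) (hψm : Measurable ψ)
    (hh : ∀ i, Measurable (h i)) {order : ℕ → Finset ℕ → List ℕ}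
    (horder : ∀ t F, (order t F : Multiset ℕ) = F.val) (d : A → ℕ → ℕ) (s₀ : S) (t : ℕ) :
    ∫⁻ b, ψ (run alg h order d b s₀ t).base ∂(Measure.infinitePi fun _ : ℕ => ν) = ψ s₀ := by
  induction t with
  | zero => simp [run]
  | succ t ih =>
    have h1 : ∀ m, ∫⁻ b, ψ ((feedOnce alg h b)^[m] (run alg h order d b s₀ t)).base
        ∂(Measure.infinitePi fun _ : ℕ => ν) = ψ s₀ := by
      intro m
      induction m with
      | zero => exact ih
      | succ m ihm => rw [lintegral_iterate_feedOnce_succ hψ hψm hh horder, ihm]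
    -- The loop of instant `t` amounts to `t` passes, and the rest of the instant leaves the base
    -- state alone.
    rw [← h1 t]
    refine lintegral_congr fun b => ?_
    rw [← drain_run_eq_iterate alg h horder]
    rfl

end QPMD

end Harmonic

/-! ### The harmonic function that counts predictions of `i`. -/

section Tally

variable {A H S B : Type*} [DecidableEq A] [MeasurableSpace H] [MeasurableSpace S]

namespace BaseAlg

/-- The base algorithm with a countdown of its remaining steps and, for each prediction, a count of
how often it received feedback for it before the countdown reached zero. -/
def tally [Fintype A] (alg : BaseAlg A H S) : BaseAlg A H (S × ℕ × (A → ℕ)) where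
  predict x := alg.predict x.1
  update x y := (alg.update x.1 y, x.2.1 - 1,
    if x.2.1 = 0 then x.2.2
    else Function.update x.2.2 (alg.predict x.1) (x.2.2 (alg.predict x.1) + 1))
  measurableSet_predict i := measurable_fst (alg.measurableSet_predict i)
  measurable_update := by
    have h1 : Measurable fun p : (S × ℕ × (A → ℕ)) × H => p.1.1 := by fun_prop
    have h2 : Measurable fun p : (S × ℕ × (A → ℕ)) × H => p.1.2 := by fun_prop
    refine (alg.measurable_update.comp (h1.prodMk measurable_snd)).prodMk
      (Measurable.prodMk ?_ ?_)
    · exact h2.measurableFibers.measurable_comp fun k => k.1 - 1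
    · exact ((alg.measurableFibers_predict h1).prodMk h2.measurableFibers).measurable_comp
        fun k => if k.2.1 = 0 then k.2.2 else Function.update k.2.2 k.1 (k.2.2 k.1 + 1)

variable [MeasurableSpace B]

/-- Expected number of predictions of `i` in `k` steps from a given state, for i.i.d. outcomes with
distribution `ν`. -/
noncomputable def expectedPred (alg : BaseAlg A H S) (h : A → B → H) (ν : Measure B) (i : A) :
    ℕ → S → ℝ≥0∞
  | 0, _ => 0
  | k + 1, x => (if alg.predict x = i then 1 else 0) +
      ∫⁻ y, expectedPred alg h ν i k (alg.update x (h (alg.predict x) y)) ∂ν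

/-- Number of feedbacks for `i` so far plus the expected number of further predictions of `i` until
the countdown ends. -/
noncomputable def tallyValue (alg : BaseAlg A H S) (h : A → B → H) (ν : Measure B) (i : A)
    (x : S × ℕ × (A → ℕ)) : ℝ≥0∞ :=
  x.2.2 i + alg.expectedPred h ν i x.2.1 x.1

variable [Fintype A] (alg : BaseAlg A H S) {h : A → B → H} (hh : ∀ i, Measurable (h i))
  (ν : Measure B) [IsProbabilityMeasure ν] (i : A)

include hh in
lemma measurable_expectedPred (k : ℕ) : Measurable (alg.expectedPred h ν i k) := by
  induction k with
  | zero => exact measurable_const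
  | succ k ih =>
    refine ((alg.measurableFibers_predict measurable_id).measurable_comp
      fun j => if j = i then (1 : ℝ≥0∞) else 0).add ?_
    refine Measurable.lintegral_prod_right' (f := fun p : S × B =>
      alg.expectedPred h ν i k (alg.update p.1 (h (alg.predict p.1) p.2))) (ih.comp ?_)
    exact alg.measurable_update_comp hh measurable_fst
      (alg.measurableFibers_predict measurable_fst) measurable_snd

include hh in
lemma measurable_tallyValue : Measurable (alg.tallyValue h ν i) := by
  have h2 : Measurable fun x : S × ℕ × (A → ℕ) => x.2 := by fun_prop
  exact h2.measurableFibers.measurable_comp₂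
    (g := fun k x => (k.2 i : ℝ≥0∞) + alg.expectedPred h ν i k.1 x.1)
    fun k => measurable_const.add ((alg.measurable_expectedPred hh ν i k.1).comp measurable_fst)

/-- A step moves the first term of the recursion for `expectedPred` into the tally and averages the
rest over the outcome. -/
lemma isHarmonic_tallyValue : alg.tally.IsHarmonic h ν (alg.tallyValue h ν i) := by
  rintro ⟨x, k, c⟩
  rcases k with _ | k
  -- After the countdown, `0 - 1 = 0` and the frozen tally keep the value constant, so harmonicity
  -- holds in every state.
  · simp [tally, tallyValue, expectedPred]
  · simp only [tally, tallyValue, expectedPred, Nat.add_sub_cancel, Nat.add_one_ne_zero, if_false]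
    rw [lintegral_add_left measurable_const, ← add_assoc]
    congr 1
    simp only [lintegral_const, measure_univ, mul_one]
    rcases eq_or_ne (alg.predict x) i with rfl | hne
    · simp
    · simp [hne, Function.update_of_ne hne.symm]

variable (h) in
omit [MeasurableSpace B] in
lemma run_tally (b : ℕ → B) (s₀ : S) (n t : ℕ) (htn : t ≤ n) :
    alg.tally.run h b (s₀, n, fun _ => 0) t =
      (alg.run h b s₀ t, n - t, fun j => numPred (alg.action h b s₀) j t) := by
  induction t with
  | zero => simp [run, numPred]
  | succ t ih =>
    have hne : n - t ≠ 0 := by omega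
    rw [run, ih (by omega)]
    simp only [tally, run, hne, if_false, Prod.mk.injEq, true_and]
    refine ⟨by omega, ?_⟩
    funext j
    simp only [numPred, Finset.range_add_one, Finset.filter_insert]
    rcases eq_or_ne j (alg.predict (alg.run h b s₀ t)) with rfl | hj
    · rw [Function.update_self, if_pos (show alg.action h b s₀ t = alg.predict (alg.run h b s₀ t) from rfl),
        Finset.card_insert_of_notMem (by simp)]
    · rw [Function.update_of_ne hj, if_neg (show ¬ alg.action h b s₀ t = j from hj.symm)]

variable (h) in
omit [IsProbabilityMeasure ν] in
-- The countdown is exhausted after `n` steps, which leaves only the tally.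
lemma tallyValue_run (b : ℕ → B) (s₀ : S) (n : ℕ) :
    alg.tallyValue h ν i (alg.tally.run h b (s₀, n, fun _ => 0) n) =
      numPred (alg.action h b s₀) i n := by
  rw [run_tally alg h b s₀ n n le_rfl]
  simp [tallyValue, expectedPred]

end BaseAlg

/-! ### The pathwise bound on the predictions of the queued algorithm. -/

namespace QPMD

variable [Fintype A] (alg : BaseAlg A H S) (h : A → B → H)

/-- Forget the tally in a configuration. -/
def untally (c : QPMD A (S × ℕ × (A → ℕ))) : QPMD A S where
  base := c.base.1
  queue := c.queue
  past := c.past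

lemma untally_feedOnce (b : ℕ → B) (c : QPMD A (S × ℕ × (A → ℕ))) :
    untally (feedOnce alg.tally h b c) = feedOnce alg h b (untally c) := by
  rcases hq : c.queue (alg.predict c.base.1) with _ | ⟨s, q⟩
  · rw [feedOnce_of_nil _ _ _ (c := untally c) hq, feedOnce_of_nil _ _ _ (c := c) hq]
  · rw [feedOnce_of_cons _ _ _ (c := untally c) hq, feedOnce_of_cons _ _ _ (c := c) hq]
    rfl

lemma untally_drain (b : ℕ → B) (c : QPMD A (S × ℕ × (A → ℕ))) :
    untally (drain alg.tally h b c) = drain alg h b (untally c) :=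
  (Function.Semiconj.iterate_right (untally_feedOnce alg h b) c.buffered) c

lemma untally_step (order : ℕ → Finset ℕ → List ℕ) (d : A → ℕ → ℕ) (b : ℕ → B) (t : ℕ)
    (c : QPMD A (S × ℕ × (A → ℕ))) :
    untally (step alg.tally h order d b t c) = step alg h order d b t (untally c) := by
  have h1 := untally_drain alg h b c
  simp only [step]
  rw [← h1]
  rfl

lemma untally_run (order : ℕ → Finset ℕ → List ℕ) (d : A → ℕ → ℕ) (b : ℕ → B) (s₀ : S)
    (k : ℕ × (A → ℕ)) (t : ℕ) :
    untally (run alg.tally h order d b (s₀, k) t) = run alg h order d b s₀ t := by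
  induction t with
  | zero => rfl
  | succ t ih => rw [run, untally_step, ih]; rfl

/-- Predictions never read the counters, so the tally is a mere observer. -/
lemma action_tally (order : ℕ → Finset ℕ → List ℕ) (d : A → ℕ → ℕ) (b : ℕ → B) (s₀ : S)
    (k : ℕ × (A → ℕ)) :
    action alg.tally h order d b (s₀, k) = action alg h order d b s₀ := by
  funext t
  have h1 := untally_drain alg h b (run alg.tally h order d b (s₀, k) t)
  rw [untally_run] at h1
  rw [action, action, ← h1]
  rfl

/-- At an instant with `R j` received feedbacks for each `j`, every received feedback is either
buffered or counted by the tally. -/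
structure TallyInv (n : ℕ) (R : A → ℕ) (c : QPMD A (S × ℕ × (A → ℕ))) : Prop where
  countdown : c.base.2.1 + ∑ j, c.base.2.2 j = n
  received : ∀ j, c.base.2.2 j + (c.queue j).length = R j

variable {alg h}

omit [DecidableEq A] [MeasurableSpace S] in
-- The base algorithm has consumed at most as many feedbacks as were received, which is fewer than
-- `n`.
lemma TallyInv.countdown_pos {n : ℕ} {R : A → ℕ} {c : QPMD A (S × ℕ × (A → ℕ))}
    (hc : TallyInv n R c) (hR : ∑ j, R j < n) : 0 < c.base.2.1 := by
  have h1 : ∑ j, c.base.2.2 j ≤ ∑ j, R j :=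
    Finset.sum_le_sum fun j _ => by have := hc.received j; omega
  have := hc.countdown
  omega

lemma feedOnce_tally_of_cons {b : ℕ → B} {c : QPMD A (S × ℕ × (A → ℕ))} {s : ℕ} {q : List ℕ}
    (hq : c.queue (alg.predict c.base.1) = s :: q) (hk : 0 < c.base.2.1) :
    feedOnce alg.tally h b c =
      { base := (alg.update c.base.1 (h (c.past s) (b s)), c.base.2.1 - 1,
          Function.update c.base.2.2 (alg.predict c.base.1)
            (c.base.2.2 (alg.predict c.base.1) + 1))
        queue := Function.update c.queue (alg.predict c.base.1) q
        past := c.past } := by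
  rw [feedOnce_of_cons alg.tally h b (c := c) hq]
  simp [BaseAlg.tally, hk.ne']

lemma TallyInv.feedOnce {n : ℕ} {R : A → ℕ} {c : QPMD A (S × ℕ × (A → ℕ))}
    (hc : TallyInv n R c) (hR : ∑ j, R j < n) (b : ℕ → B) :
    TallyInv n R (feedOnce alg.tally h b c) := by
  rcases hq : c.queue (alg.predict c.base.1) with _ | ⟨s, q⟩
  · rwa [feedOnce_of_nil _ _ _ (c := c) hq]
  · have hk := hc.countdown_pos hR
    rw [feedOnce_tally_of_cons hq hk]
    refine ⟨?_, fun j => ?_⟩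
    · have h1 := hc.countdown
      have h2 := Finset.add_sum_erase Finset.univ c.base.2.2
        (Finset.mem_univ (alg.predict c.base.1))
      simp only [Finset.sum_update_of_mem (Finset.mem_univ _), Finset.sdiff_singleton_eq_erase]
      omega
    · rcases eq_or_ne j (alg.predict c.base.1) with rfl | hj
      · have h1 := hc.received (alg.predict c.base.1)
        rw [hq, List.length_cons] at h1
        simp only [Function.update_self]
        omega
      · simpa only [Function.update_of_ne hj] using hc.received j

/-- Feeding the base algorithm does not decrease the number of its predictions of `i`, including
the current one. -/
lemma tally_add_current_le_feedOnce {c : QPMD A (S × ℕ × (A → ℕ))} (hk : 0 < c.base.2.1)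
    (b : ℕ → B) (i : A) :
    c.base.2.2 i + (if alg.predict c.base.1 = i then 1 else 0) ≤
      (feedOnce alg.tally h b c).base.2.2 i +
        (if alg.predict (feedOnce alg.tally h b c).base.1 = i then 1 else 0) := by
  rcases hq : c.queue (alg.predict c.base.1) with _ | ⟨s, q⟩
  · rw [feedOnce_of_nil _ _ _ (c := c) hq]
  · rw [feedOnce_tally_of_cons hq hk]
    -- Popping a feedback for `i` trades the unit of the current prediction for a unit of the tally.
    rcases eq_or_ne (alg.predict c.base.1) i with rfl | hj
    · simp
    · simp [Function.update_of_ne hj.symm, hj]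

lemma TallyInv.iterate_feedOnce {n : ℕ} {R : A → ℕ} {c : QPMD A (S × ℕ × (A → ℕ))}
    (hc : TallyInv n R c) (hR : ∑ j, R j < n) (b : ℕ → B) (i : A) (m : ℕ) :
    TallyInv n R ((QPMD.feedOnce alg.tally h b)^[m] c) ∧
    c.base.2.2 i + (if alg.predict c.base.1 = i then 1 else 0) ≤
      ((QPMD.feedOnce alg.tally h b)^[m] c).base.2.2 i +
        (if alg.predict ((QPMD.feedOnce alg.tally h b)^[m] c).base.1 = i then 1 else 0) := by
  induction m with
  | zero => exact ⟨hc, le_rfl⟩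
  | succ m ih =>
    rw [Function.iterate_succ_apply']
    exact ⟨ih.1.feedOnce hR b,
      ih.2.trans (tally_add_current_le_feedOnce (ih.1.countdown_pos hR) b i)⟩

omit [MeasurableSpace H] [MeasurableSpace S] in
lemma sum_numPred (a : ℕ → A) (t : ℕ) : ∑ j, numPred a j t = t := by
  simp only [numPred]
  rw [← Finset.card_eq_sum_card_fiberwise (fun _ _ => Finset.mem_coe.2 (Finset.mem_univ _)),
    Finset.card_range]

variable (alg h) {order : ℕ → Finset ℕ → List ℕ}
  (horder : ∀ t F, (order t F : Multiset ℕ) = F.val) (d : A → ℕ → ℕ) (b : ℕ → B) (s₀ : S) (n : ℕ)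

include horder in
-- Positivity of the countdown is a separate clause because at `t = n` all `n` feedbacks may have
-- been received. The base state then still dates from the loop of instant `n - 1`, before which
-- fewer than `n` had arrived.
lemma tallyInv_run {t : ℕ} (htn : t ≤ n) :
    TallyInv n (fun j => numReceived d (action alg h order d b s₀) j t)
        (run alg.tally h order d b (s₀, n, fun _ => 0) t) ∧
      (0 < n → 0 < (run alg.tally h order d b (s₀, n, fun _ => 0) t).base.2.1) ∧
      ∀ i, numPred (action alg h order d b s₀) i t ≤
        maxMissing d (action alg h order d b s₀) i t +
          ((run alg.tally h order d b (s₀, n, fun _ => 0) t).base.2.2 i +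
            (if alg.predict (run alg.tally h order d b (s₀, n, fun _ => 0) t).base.1 = i
              then 1 else 0)) := by
  induction t with
  | zero => exact ⟨⟨by simp [run], by simp [run, numReceived]⟩, id, by simp [numPred]⟩
  | succ t ih =>
    obtain ⟨hinv, -, hle⟩ := ih (by omega)
    have hR : ∑ j, numReceived d (action alg h order d b s₀) j t < n := by
      have h1 : ∑ j, numReceived d (action alg h order d b s₀) j t ≤ t :=
        (Finset.sum_le_sum fun j _ => numReceived_le_numPred d _ j t).trans_eq (sum_numPred _ t)
      omega
    have hinv' := fun i => hinv.iterate_feedOnce (alg := alg) (h := h) hR b i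
      (run alg.tally h order d b (s₀, n, fun _ => 0) t).buffered
    have hact : ∀ i, action alg h order d b s₀ t = i ↔
        alg.predict (drain alg.tally h b
          (run alg.tally h order d b (s₀, n, fun _ => 0) t)).base.1 = i := by
      intro i
      rw [← action_tally alg h order d b s₀ (n, fun _ => 0)]
      rfl
    have hlen := length_queue_run_succ alg.tally h horder d b (s₀, n, fun _ => 0) t
    rw [action_tally] at hlen
    have hempty := queue_drain alg.tally h b (run alg.tally h order d b (s₀, n, fun _ => 0) t)
    have hbase : (run alg.tally h order d b (s₀, n, fun _ => 0) (t + 1)).base =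
      (drain alg.tally h b (run alg.tally h order d b (s₀, n, fun _ => 0) t)).base := rfl
    rw [hbase]
    change ∀ i, TallyInv n _ (drain alg.tally h b _) ∧ _ ≤ (drain alg.tally h b _).base.2.2 i +
      (if alg.predict (drain alg.tally h b _).base.1 = i then 1 else 0) at hinv'
    generalize drain alg.tally h b (run alg.tally h order d b (s₀, n, fun _ => 0) t) = c at *
    have hc := (hinv' (alg.predict c.base.1)).1
    refine ⟨⟨hbase ▸ hc.countdown, fun j => ?_⟩, fun _ => hc.countdown_pos hR, fun i => ?_⟩
    · have h1 := hc.received j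
      have h2 := hlen j
      rw [hbase]
      omega
    · have hG : maxMissing d (action alg h order d b s₀) i (t + 1) =
          numMissing d (action alg h order d b s₀) i t ⊔
            maxMissing d (action alg h order d b s₀) i t := by
        simp [maxMissing, Finset.range_add_one]
      have hT : numPred (action alg h order d b s₀) i (t + 1) =
          numPred (action alg h order d b s₀) i t +
            if action alg h order d b s₀ t = i then 1 else 0 := by
        simp only [numPred, Finset.range_add_one, Finset.filter_insert]
        split_ifs <;> simp
      rw [hG, hT]
      simp only [hact]
      -- If `i` is predicted, its buffer is empty, so the tally equals `S_i(t)`, the earlier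
      -- predictions number `G + S_i(t)`, and the new one is the current-prediction term. Otherwise
      -- `T_i` stays put and the tally with its current-prediction term has not decreased.
      split_ifs with hi
      · have h1 := hc.received i
        have h2 : (c.queue i).length = 0 := by
          rw [← hi]; exact List.length_eq_zero_iff.2 hempty
        have h3 := numReceived_le_numPred d (action alg h order d b s₀) i t
        have h4 : numMissing d (action alg h order d b s₀) i t =
          numPred (action alg h order d b s₀) i t -
            numReceived d (action alg h order d b s₀) i t := rfl
        have h5 := le_sup_left (a := numMissing d (action alg h order d b s₀) i t)
          (b := maxMissing d (action alg h order d b s₀) i t)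
        omega
      · have h1 := hle i
        have h2 := (hinv' i).2
        have h5 := le_sup_right (a := numMissing d (action alg h order d b s₀) i t)
          (b := maxMissing d (action alg h order d b s₀) i t)
        rw [if_neg hi] at h2
        omega

include horder in
lemma numPred_le_maxMissing_add_tallyValue [MeasurableSpace B] (ν : Measure B) (i : A) :
    (numPred (action alg h order d b s₀) i n : ℝ≥0∞) ≤
      maxMissing d (action alg h order d b s₀) i n +
        alg.tallyValue h ν i (run alg.tally h order d b (s₀, n, fun _ => 0) n).base := by
  rcases Nat.eq_zero_or_pos n with rfl | hn
  · simp [numPred]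
  obtain ⟨-, hpos, hle⟩ := tallyInv_run alg h horder d b s₀ n (t := n) le_rfl
  generalize (run alg.tally h order d b (s₀, n, fun _ => 0) n).base = x at *
  obtain ⟨x, k, c⟩ := x
  -- A nonzero countdown lets `expectedPred` unfold once; its first term is the current-prediction
  -- indicator of the pathwise bound.
  obtain ⟨k, rfl⟩ := Nat.exists_eq_add_one.2 (hpos hn)
  have h1 : (numPred (action alg h order d b s₀) i n : ℝ≥0∞) ≤
      maxMissing d (action alg h order d b s₀) i n +
        (c i + (if alg.predict x = i then 1 else 0)) := by
    exact_mod_cast hle i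
  refine h1.trans ?_
  simp only [BaseAlg.tallyValue, BaseAlg.expectedPred]
  gcongr
  exact le_self_add

end QPMD

end Tally

/-! ### Expected regret through gaps and counts. -/

section ExpectedRegret

variable {A B Z Ω : Type*} [Fintype A] [DecidableEq A] [MeasurableSpace B] [MeasurableSpace Z]
  [MeasurableSpace Ω] {P : Measure Ω} [IsProbabilityMeasure P] {b : ℕ → Ω → B} {z : Ω → Z}

omit [Fintype A] [MeasurableSpace Ω] in
lemma natCast_numPred_eq_sum_indicator (a : Ω → ℕ → A) (i : A) (n : ℕ) (ω : Ω) :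
    (numPred (a ω) i n : ℝ) =
      ∑ t ∈ Finset.range n, {ω | a ω t = i}.indicator (1 : Ω → ℝ) ω := by
  simp [numPred, Set.indicator_apply, Finset.sum_boole]

/-- Wald-type identity for predictions that depend on `z` and on the outcomes, but not on the
current one. -/
lemma integral_reward_eq_sum (hb : ∀ t, Measurable (b t)) (hz : Measurable z)
    (hlaw : P.map (fun ω => (z ω, fun t => b t ω)) =
      (P.map z).prod (Measure.infinitePi fun _ : ℕ => P.map (b 0)))
    {act : Z → (ℕ → B) → ℕ → A}
    (hact : ∀ t, MeasurableFibers fun p : Z × (ℕ → B) => act p.1 p.2 t)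
    (hup : ∀ x c t y, act x (Function.update c t y) t = act x c t)
    {f : A → B → ℝ} (hf : ∀ i, Measurable (f i))
    (hf_int : ∀ i t, Integrable (fun ω => f i (b t ω)) P) (t : ℕ) :
    Integrable (fun ω => f (act (z ω) (fun t => b t ω) t) (b t ω)) P ∧
      ∫ ω, f (act (z ω) (fun t => b t ω) t) (b t ω) ∂P =
        ∑ i, (∫ ω, {ω | act (z ω) (fun t => b t ω) t = i}.indicator (1 : Ω → ℝ) ω ∂P) *
          ∫ ω, f i (b 0 ω) ∂P := by
  have hpair : Measurable fun ω => (z ω, fun t => b t ω) := hz.prodMk (measurable_pi_lambda _ hb)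
  have : IsProbabilityMeasure (P.map z) := Measure.isProbabilityMeasure_map hz.aemeasurable
  have : IsProbabilityMeasure (P.map (b 0)) :=
    Measure.isProbabilityMeasure_map (hb 0).aemeasurable
  have hE : ∀ i, MeasurableSet {ω | act (z ω) (fun t => b t ω) t = i} := fun i => hpair (hact t i)
  have hsum : ∀ ω, f (act (z ω) (fun t => b t ω) t) (b t ω) =
      ∑ i, {ω | act (z ω) (fun t => b t ω) t = i}.indicator (1 : Ω → ℝ) ω * f i (b t ω) := by
    intro ω
    simp [Set.indicator_apply]
  have hint : ∀ i, Integrable (fun ω =>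
      {ω | act (z ω) (fun t => b t ω) t = i}.indicator (1 : Ω → ℝ) ω * f i (b t ω)) P := by
    intro i
    refine ((hf_int i t).indicator (hE i)).congr (Filter.Eventually.of_forall fun ω => ?_)
    simp [Set.indicator_apply]
  simp only [hsum]
  refine ⟨integrable_finsetSum _ fun i _ => hint i, ?_⟩
  rw [integral_finsetSum _ fun i _ => hint i]
  refine Finset.sum_congr rfl fun i _ => ?_
  have hE' : MeasurableSet {p : Z × (ℕ → B) | act p.1 p.2 t = i} := hact t i
  have h1 := integral_indicator_mul_of_update_iff (P.map z) (P.map (b 0)) t hE'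
    (fun x c y => by simp [hup]) (hf i)
  rw [← hlaw, integral_map hpair.aemeasurable, integral_map hpair.aemeasurable,
    integral_map (hb 0).aemeasurable (hf i).aestronglyMeasurable] at h1
  · exact h1
  · exact (measurable_one.indicator hE').aestronglyMeasurable
  · exact ((measurable_one.indicator hE').mul
      ((hf i).comp ((measurable_pi_apply t).comp measurable_snd))).aestronglyMeasurable

omit [Fintype A] in
lemma integrable_numPred {a : Ω → ℕ → A} (ha : ∀ t, MeasurableFibers fun ω => a ω t) (i : A)
    (n : ℕ) : Integrable (fun ω => (numPred (a ω) i n : ℝ)) P := by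
  simp only [natCast_numPred_eq_sum_indicator a]
  exact integrable_finsetSum _ fun t _ => (integrable_const 1).indicator (ha t i)

lemma integral_stochRegret (hb : ∀ t, Measurable (b t)) (hz : Measurable z)
    (hlaw : P.map (fun ω => (z ω, fun t => b t ω)) =
      (P.map z).prod (Measure.infinitePi fun _ : ℕ => P.map (b 0)))
    {act : Z → (ℕ → B) → ℕ → A}
    (hact : ∀ t, MeasurableFibers fun p : Z × (ℕ → B) => act p.1 p.2 t)
    (hup : ∀ x c t y, act x (Function.update c t y) t = act x c t)
    {r : A → B → ℝ} (hr : ∀ i, Measurable (r i))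
    (hr_int : ∀ i t, Integrable (fun ω => r i (b t ω)) P) (n : ℕ) :
    Integrable (fun ω => stochRegret (bestMean P r (b 0)) r (fun t => b t ω)
        (act (z ω) fun t => b t ω) n) P ∧
      ∫ ω, stochRegret (bestMean P r (b 0)) r (fun t => b t ω) (act (z ω) fun t => b t ω) n ∂P =
        ∑ i, gap P r (b 0) i * ∫ ω, (numPred (act (z ω) fun t => b t ω) i n : ℝ) ∂P := by
  have hpair : Measurable fun ω => (z ω, fun t => b t ω) := hz.prodMk (measurable_pi_lambda _ hb)
  have key := integral_reward_eq_sum hb hz hlaw hact hup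
    (f := fun i x => bestMean P r (b 0) - r i x) (fun i => measurable_const.sub (hr i))
    fun i t => (integrable_const _).sub (hr_int i t)
  have hgap : ∀ i, ∫ ω, (bestMean P r (b 0) - r i (b 0 ω)) ∂P = gap P r (b 0) i := by
    intro i
    rw [integral_sub (integrable_const _) (hr_int i 0)]
    simp [gap, meanReward]
  unfold stochRegret
  refine ⟨integrable_finsetSum _ fun t _ => (key t).1, ?_⟩
  rw [integral_finsetSum _ fun t _ => (key t).1, Finset.sum_congr rfl fun t _ => (key t).2,
    Finset.sum_comm]
  refine Finset.sum_congr rfl fun i _ => ?_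
  simp only [natCast_numPred_eq_sum_indicator fun ω => act (z ω) fun t => b t ω]
  rw [integral_finsetSum _ fun t _ => (integrable_const 1).indicator (hpair (hact t i)),
    Finset.mul_sum]
  exact Finset.sum_congr rfl fun t _ => by rw [hgap, mul_comm]

omit [DecidableEq A] [MeasurableSpace B] [IsProbabilityMeasure P] in
lemma gap_nonneg (r : A → B → ℝ) (c : Ω → B) (i : A) : 0 ≤ gap P r c i :=
  sub_nonneg.2 (le_ciSup (f := meanReward P r c) (Set.finite_range _).bddAbove i)

omit [Fintype A] [DecidableEq A] [MeasurableSpace B] in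
-- The bracket does not involve the predictions `a`, so bounds between two algorithms carry over
-- from one notion of regret to the other.
lemma hindsightRegret_eq (m : ℝ) (r : A → B → ℝ) (c : ℕ → B) (a : ℕ → A) (n : ℕ) :
    hindsightRegret r c a n =
      ((⨆ i, ∑ t ∈ Finset.range n, r i (c t)) - n * m) + stochRegret m r c a n := by
  simp [hindsightRegret, stochRegret, Finset.sum_sub_distrib]

omit [DecidableEq A] [MeasurableSpace B] [IsProbabilityMeasure P] in
lemma integrable_iSup_sum [Nonempty A] {r : A → B → ℝ}
    (hr_int : ∀ i t, Integrable (fun ω => r i (b t ω)) P) (n : ℕ) :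
    Integrable (fun ω => ⨆ i, ∑ t ∈ Finset.range n, r i (b t ω)) P := by
  have h1 : (fun ω => ⨆ i, ∑ t ∈ Finset.range n, r i (b t ω)) =
      Finset.univ.sup' Finset.univ_nonempty fun i ω => ∑ t ∈ Finset.range n, r i (b t ω) := by
    funext ω
    rw [Finset.sup'_apply, Finset.sup'_univ_eq_ciSup]
  rw [h1]
  exact Finset.sup'_induction _ _ (p := fun f : Ω → ℝ => Integrable f P)
    (fun _ hf _ hg => hf.sup hg) fun i _ => integrable_finsetSum _ fun t _ => hr_int i t

end ExpectedRegret

/-! ### Comparison of expected counts and the final theorem. -/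

/-- In expectation, the queued algorithm predicts `i` at most as often as the base algorithm does
without delays, plus the largest number of missing feedbacks for `i`. -/
lemma lintegral_numPred_le {A B H S Ω : Type*} [Fintype A] [DecidableEq A] [MeasurableSpace B]
    [MeasurableSpace H] [MeasurableSpace S] [MeasurableSpace Ω] {P : Measure Ω}
    [IsProbabilityMeasure P] {h : A → B → H} (hh : ∀ i, Measurable (h i)) {b : ℕ → Ω → B}
    (hb : ∀ t, Measurable (b t)) (alg : BaseAlg A H S) {z : Ω → S × (A → ℕ → ℕ)}
    (hz : Measurable z)
    (hlaw : P.map (fun ω => (z ω, fun t => b t ω)) =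
      (P.map z).prod (Measure.infinitePi fun _ : ℕ => P.map (b 0)))
    {order : ℕ → Finset ℕ → List ℕ} (horder : ∀ t F, (order t F : Multiset ℕ) = F.val)
    (i : A) (n : ℕ) :
    ∫⁻ ω, (numPred (QPMD.action alg h order (z ω).2 (fun t => b t ω) (z ω).1) i n : ℝ≥0∞) ∂P ≤
      ∫⁻ ω, (numPred (alg.action h (fun t => b t ω) (z ω).1) i n : ℝ≥0∞) ∂P +
      ∫⁻ ω, (maxMissing (z ω).2 (QPMD.action alg h order (z ω).2 (fun t => b t ω) (z ω).1) i n :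
        ℝ≥0∞) ∂P := by
  have hpair : Measurable fun ω => (z ω, fun t => b t ω) := hz.prodMk (measurable_pi_lambda _ hb)
  have : IsProbabilityMeasure (P.map (b 0)) :=
    Measure.isProbabilityMeasure_map (hb 0).aemeasurable
  have hψm := alg.measurable_tallyValue hh (P.map (b 0)) i
  have hψ := alg.isHarmonic_tallyValue (h := h) (P.map (b 0)) i
  have hs : Measurable fun p : (S × (A → ℕ → ℕ)) × (ℕ → B) =>
      (p.1.1, n, fun _ : A => (0 : ℕ)) := by fun_prop
  have hd : Measurable fun p : (S × (A → ℕ → ℕ)) × (ℕ → B) => p.1.2 := by fun_prop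
  have hF : Measurable fun p : (S × (A → ℕ → ℕ)) × (ℕ → B) =>
      alg.tallyValue h (P.map (b 0)) i (alg.tally.run h p.2 (p.1.1, n, fun _ => 0) n) :=
    hψm.comp (alg.tally.measurable_run hh measurable_snd hs n)
  have hG : Measurable fun p : (S × (A → ℕ → ℕ)) × (ℕ → B) =>
      alg.tallyValue h (P.map (b 0)) i
        (QPMD.run alg.tally h order p.1.2 p.2 (p.1.1, n, fun _ => 0) n).base :=
    hψm.comp (QPMD.isMeasurable_run alg.tally hh measurable_snd order hd hs n).base
  have hmax : Measurable fun ω => (maxMissing (z ω).2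
      (QPMD.action alg h order (z ω).2 (fun t => b t ω) (z ω).1) i n : ℝ≥0∞) :=
    measurable_from_top.comp (measurable_maxMissing hz.snd (QPMD.measurableFibers_action alg hh
      (measurable_pi_lambda _ hb) order hz.snd hz.fst) i n)
  -- For each fixed initial state and delay table both inner integrals equal the harmonic function
  -- at the start; the product law allows integrating these out last.
  have heq : ∫⁻ ω, alg.tallyValue h (P.map (b 0)) i (QPMD.run alg.tally h order (z ω).2
        (fun t => b t ω) ((z ω).1, n, fun _ => 0) n).base ∂P =
      ∫⁻ ω, (numPred (alg.action h (fun t => b t ω) (z ω).1) i n : ℝ≥0∞) ∂P := by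
    simp only [← alg.tallyValue_run h (P.map (b 0))]
    have h1 := lintegral_map (μ := P) hF hpair
    have h2 := lintegral_map (μ := P) hG hpair
    rw [hlaw, lintegral_prod _ hF.aemeasurable] at h1
    rw [hlaw, lintegral_prod _ hG.aemeasurable] at h2
    rw [← h1, ← h2]
    refine lintegral_congr fun x => ?_
    exact (QPMD.lintegral_run hψ hψm hh horder x.2 (x.1, n, fun _ => 0) n).trans
      (hψ.lintegral_run hψm hh (x.1, n, fun _ => 0) n).symm
  rw [← heq, add_comm, ← lintegral_add_left hmax]
  exact lintegral_mono fun ω => QPMD.numPred_le_maxMissing_add_tallyValue alg h horder _ _ _ n _ i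

theorem theorem2
    {A B H S Ω : Type*} [Fintype A] [Nonempty A] [DecidableEq A]
    [MeasurableSpace B] [MeasurableSpace H] [MeasurableSpace S] [MeasurableSpace Ω]
    (P : Measure Ω) [IsProbabilityMeasure P]
    -- reward and feedback functions
    (r : A → B → ℝ) (hr : ∀ i, Measurable (r i))
    (h : A → B → H) (hh : ∀ i, Measurable (h i))
    -- i.i.d. outcomes, with integrable rewards
    (b : ℕ → Ω → B) (hb : ∀ t, Measurable (b t))
    (hb_indep : iIndepFun b P) (hb_ident : ∀ t, IdentDistrib (b t) (b 0) P P)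
    (hr_int : ∀ i, Integrable (fun ω => r i (b 0 ω)) P)
    -- the base algorithm with its random initial state
    (alg : BaseAlg A H S) (s₀ : Ω → S) (hs₀ : Measurable s₀)
    -- delays of the feedbacks, which may depend on the predictions
    (τ : A → ℕ → Ω → ℕ) (hτ : ∀ i t, Measurable (τ i t))
    -- the outcomes are independent of the delays and of the randomization of the algorithm
    (h_indep : IndepFun (fun ω => (s₀ ω, fun (i : A) (t : ℕ) => τ i t ω))
      (fun ω (t : ℕ) => b t ω) P)
    -- the order in which simultaneously arriving feedbacks are buffered
    (order : ℕ → Finset ℕ → List ℕ) (horder : ∀ t F, (order t F : Multiset ℕ) = F.val)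
    (n : ℕ) :
    -- outcome sequence, delays, and predictions of the two algorithms
    let b' : Ω → ℕ → B := fun ω t => b t ω
    let d : Ω → A → ℕ → ℕ := fun ω i t => τ i t ω
    let aQ : Ω → ℕ → A := fun ω => QPMD.action alg h order (d ω) (b' ω) (s₀ ω)
    let aBase : Ω → ℕ → A := fun ω => alg.action h (b' ω) (s₀ ω)
    let m : ℝ := bestMean P r (b 0)
    let Δ : A → ℝ := gap P r (b 0)
    -- all quantities below have finite expectations
    (Integrable (fun ω => stochRegret m r (b' ω) (aQ ω) n) P ∧
      Integrable (fun ω => stochRegret m r (b' ω) (aBase ω) n) P ∧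
      Integrable (fun ω => hindsightRegret r (b' ω) (aQ ω) n) P ∧
      Integrable (fun ω => hindsightRegret r (b' ω) (aBase ω) n) P ∧
      (∀ i, Integrable (fun ω => (numPred (aQ ω) i n : ℝ)) P) ∧
      (∀ i, Integrable (fun ω => (numPred (aBase ω) i n : ℝ)) P) ∧
      ∀ i, Integrable (fun ω => (maxMissing (d ω) (aQ ω) i n : ℝ)) P) ∧
    -- the expected regrets through the gaps
    (∫ ω, stochRegret m r (b' ω) (aQ ω) n ∂P
        = ∑ i, Δ i * ∫ ω, (numPred (aQ ω) i n : ℝ) ∂P) ∧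
    (∫ ω, stochRegret m r (b' ω) (aBase ω) n ∂P
        = ∑ i, Δ i * ∫ ω, (numPred (aBase ω) i n : ℝ) ∂P) ∧
    -- the regret bound
    (∫ ω, stochRegret m r (b' ω) (aQ ω) n ∂P
        ≤ ∫ ω, stochRegret m r (b' ω) (aBase ω) n ∂P
          + ∑ i, Δ i * ∫ ω, (maxMissing (d ω) (aQ ω) i n : ℝ) ∂P) ∧
    -- the same bound for the regret in hindsight
    (∫ ω, hindsightRegret r (b' ω) (aQ ω) n ∂P
        ≤ ∫ ω, hindsightRegret r (b' ω) (aBase ω) n ∂P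
          + ∑ i, Δ i * ∫ ω, (maxMissing (d ω) (aQ ω) i n : ℝ) ∂P) := by
  intro b' d aQ aBase m Δ
  have hz : Measurable fun ω => (s₀ ω, d ω) :=
    hs₀.prodMk (measurable_pi_lambda _ fun i => measurable_pi_lambda _ fun t => hτ i t)
  have hb' : Measurable b' := measurable_pi_lambda _ hb
  have hlaw : P.map (fun ω => ((s₀ ω, d ω), b' ω)) = (P.map fun ω => (s₀ ω, d ω)).prod
      (Measure.infinitePi fun _ : ℕ => P.map (b 0)) := by
    have h1 : P.map b' = Measure.infinitePi fun _ : ℕ => P.map (b 0) := by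
      rw [show b' = fun ω t => b t ω from rfl, hb_indep.map_fun_eq_infinitePi_map hb]
      congr 1
      funext t
      exact (hb_ident t).map_eq
    rw [h_indep.map_prod_eq_prod_map_map hz.aemeasurable hb'.aemeasurable, ← h1]
  have hr_int' : ∀ i t, Integrable (fun ω => r i (b t ω)) P := fun i t =>
    ((hb_ident t).comp (hr i)).integrable_iff.2 (hr_int i)
  have hs : Measurable fun p : (S × (A → ℕ → ℕ)) × (ℕ → B) => p.1.1 := by fun_prop
  have hd : Measurable fun p : (S × (A → ℕ → ℕ)) × (ℕ → B) => p.1.2 := by fun_prop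
  obtain ⟨hQ_int, hQ_eq⟩ := integral_stochRegret hb hz hlaw
    (act := fun x c => QPMD.action alg h order x.2 c x.1)
    (QPMD.measurableFibers_action alg hh measurable_snd order hd hs)
    (fun x c t y => QPMD.action_update alg h horder x.2 c x.1 t y) hr hr_int' n
  obtain ⟨hB_int, hB_eq⟩ := integral_stochRegret hb hz hlaw
    (act := fun x c => alg.action h c x.1)
    (alg.measurableFibers_action hh measurable_snd hs)
    (fun x c t y => BaseAlg.action_update x.1 c y t) hr hr_int' n
  have haQ : ∀ t, MeasurableFibers fun ω => aQ ω t :=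
    QPMD.measurableFibers_action alg hh hb' order hz.snd hs₀
  have haB : ∀ t, MeasurableFibers fun ω => aBase ω t := alg.measurableFibers_action hh hb' hs₀
  have hQ_num : ∀ i, Integrable (fun ω => (numPred (aQ ω) i n : ℝ)) P :=
    fun i => integrable_numPred haQ i n
  have hB_num : ∀ i, Integrable (fun ω => (numPred (aBase ω) i n : ℝ)) P :=
    fun i => integrable_numPred haB i n
  have hG_num : ∀ i, Integrable (fun ω => (maxMissing (d ω) (aQ ω) i n : ℝ)) P := by
    intro i
    -- At most `t < n` predictions precede instant `t`, so no more than `n` feedbacks are missing.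
    refine Integrable.of_bound (C := n) (measurable_from_top.comp
      (measurable_maxMissing hz.snd haQ i n)).aestronglyMeasurable
      (Filter.Eventually.of_forall fun ω => ?_)
    rw [Real.norm_natCast, Nat.cast_le]
    refine Finset.sup_le fun t ht => (Nat.sub_le _ _).trans ?_
    exact (Finset.card_filter_le _ _).trans (by simpa using (Finset.mem_range.1 ht).le)
  have hnum : ∀ i, ∫ ω, (numPred (aQ ω) i n : ℝ) ∂P ≤
      ∫ ω, (numPred (aBase ω) i n : ℝ) ∂P + ∫ ω, (maxMissing (d ω) (aQ ω) i n : ℝ) ∂P := by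
    intro i
    -- Integrability of the counts makes the comparison in `ℝ≥0∞` equivalent to the real one.
    have hcast : ∀ {f : Ω → ℕ}, Integrable (fun ω => (f ω : ℝ)) P →
        ENNReal.ofReal (∫ ω, (f ω : ℝ) ∂P) = ∫⁻ ω, (f ω : ℝ≥0∞) ∂P := by
      intro f hf
      rw [ofReal_integral_eq_lintegral_ofReal hf
        (Filter.Eventually.of_forall fun ω => Nat.cast_nonneg _)]
      simp
    have h0 : ∀ {f : Ω → ℕ}, 0 ≤ ∫ ω, (f ω : ℝ) ∂P :=
      fun {f} => integral_nonneg fun ω => Nat.cast_nonneg _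
    rw [← ENNReal.ofReal_le_ofReal_iff (add_nonneg h0 h0), ENNReal.ofReal_add h0 h0,
      hcast (hQ_num i), hcast (hB_num i), hcast (hG_num i)]
    exact lintegral_numPred_le hh hb alg hz hlaw horder i n
  have hbound : ∫ ω, stochRegret m r (b' ω) (aQ ω) n ∂P ≤
      ∫ ω, stochRegret m r (b' ω) (aBase ω) n ∂P +
        ∑ i, Δ i * ∫ ω, (maxMissing (d ω) (aQ ω) i n : ℝ) ∂P := by
    refine hQ_eq.trans_le ((Finset.sum_le_sum fun i _ =>
      mul_le_mul_of_nonneg_left (hnum i) (gap_nonneg r (b 0) i)).trans_eq ?_)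
    simp only [mul_add, Finset.sum_add_distrib]
    rw [← hB_eq]
  have hsup_int : Integrable
      (fun ω => (⨆ i, ∑ t ∈ Finset.range n, r i (b' ω t)) - n * m) P :=
    (integrable_iSup_sum hr_int' n).sub (integrable_const _)
  refine ⟨⟨hQ_int, hB_int, ?_, ?_, hQ_num, hB_num, hG_num⟩, hQ_eq, hB_eq, hbound, ?_⟩
  · simp only [hindsightRegret_eq m]
    exact hsup_int.add hQ_int
  · simp only [hindsightRegret_eq m]
    exact hsup_int.add hB_int
  · simp only [hindsightRegret_eq m]
    rw [integral_add hsup_int hQ_int, integral_add hsup_int hB_int, add_assoc]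
    exact add_le_add_right hbound _
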